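/- Let $\mathbf B\in\mathbb C^{n\times n}$ be diagonalisable with simple eigenvalues. Assume that all eigenvalues of $\mathbf B$ lie in $\mathcal N\cup\mathcal H$, where $\mathcal N\subset\mathbb C$ is a bounded open set containing $0$ and $\mathcal H=\{z:\operatorname{Re} z\ge S\}$ for some $S>0$, and that $\mathcal H$ contains at least one eigenvalue of $\mathbf B$. Let $\lambda_1,\dots,\lambda_\ell$ be the (distinct) eigenvalues of $\mathbf B$ in $\mathcal N$, and assume that they are non-zero. For an eigenvalue $\lambda$ of $\mathbf B$ with right and left eigenvectors $\mathbf u,\mathbf v$ (i.e. $\mathbf B\mathbf u=\lambda\mathbf u$, $\mathbf v^*\mathbf B=\lambda\mathbf v^*$) let $\kappa(\lambda)=\|\mathbf u\|_2\|\mathbf v\|_2/|\mathbf u\cdot\mathbf v|$, where $\mathbf u\cdot\mathbf v=\mathbf v^*\mathbf u$, and let $\kappa^*$ be the maximum of $\kappa(\lambda)$ over the eigenvalues of $\mathbf B$. Given $0<L_0<L_1\le S$, let $$N_{\rm eig}=\big|\{j:\lambda_j\in\{L_0<\operatorname{Re} z<L_1\}\cap\mathcal N\}\big|+1,\qquad \delta=\frac{L_1-L_0}{4\,n\,\kappa^*\,N_{\rm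 eig}},$$ let $\|\mathbf B\|_2$ be the norm of $\mathbf B$ induced by the Euclidean norm, let $\beta\in(0,\pi/2)$ be defined by $\cos\beta=L_0/(\|\mathbf B\|_2+\delta)$, and let $\gamma_\beta=2\sin\!\big(\tfrac{\beta}{4-2\beta/\pi}\big)$. Let $\mathbf b,\mathbf x_0\in\mathbb C^n$ with $\mathbf r_0:=\mathbf b-\mathbf B\mathbf x_0\ne 0$. For an integer $m\ge 0$ let $\mathbf x_m$ be the $m$th GMRES iterate for $\mathbf B\mathbf x=\mathbf b$, i.e. the vector in $\mathbf x_0+\operatorname{span}\{\mathbf r_0,\mathbf B\mathbf r_0,\dots,\mathbf B^{m-1}\mathbf r_0\}$ minimising $\|\mathbf b-\mathbf B\mathbf x_m\|_2$, and let $\mathbf r_m:=\mathbf b-\mathbf B\mathbf x_m$. Given $\varepsilon>0$, if $$m\ \ge\ \ell+\big(\log(\gamma_\beta^{-1})\big)^{-1}\Big(\sum_{j=1}^{\ell}\log\frac1{|\lambda_j|}+\log(\varepsilon^{-1})+\log(\delta^{-1})+(\ell+1)\big(\log(\|\mathbf B\|_2+\delta)+\log 3\big)\Big),$$ then $$\frac{\|\mathbf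 r_m\|_2}{\|\mathbf r_0\|_2}\le\varepsilon .$$ -/

import Mathlib

open scoped Matrix Matrix.Norms.L2Operator

namespace GMRES

/-- All eigenvalues of `B` are simple: each is a simple root of the characteristic polynomial.
(In particular `B` is diagonalisable.) -/
def HasSimpleEigenvalues {n : ℕ} (B : Matrix (Fin n) (Fin n) ℂ) : Prop :=
  ∀ z ∈ spectrum ℂ B, B.charpoly.rootMultiplicity z = 1

/-- `c` is the condition number `‖u‖ ‖v‖ / |u ⬝ v|` of the eigenvalue `z` of `B`, where `u` is a right
eigenvector, `B u = z u`, and `v` a left eigenvector, `v* B = z v*`. For a simple eigenvalue `u` and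
`v` are unique up to non-zero factors and `u ⬝ v ≠ 0`, so that there is exactly one such `c`. -/
def IsEigenvalueCondNumber {n : ℕ} (B : Matrix (Fin n) (Fin n) ℂ) (z : ℂ) (c : ℝ) : Prop :=
  ∃ u v : EuclideanSpace ℂ (Fin n), u ≠ 0 ∧ v ≠ 0 ∧
    B *ᵥ u.ofLp = z • u.ofLp ∧ star v.ofLp ᵥ* B = z • star v.ofLp ∧
    c = ‖u‖ * ‖v‖ / ‖inner ℂ u v‖

/-- `c` is the maximum eigenvalue condition number of `B`. -/
def IsMaxEigenvalueCondNumber {n : ℕ} (B : Matrix (Fin n) (Fin n) ℂ) (c : ℝ) : Prop :=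
  IsGreatest {c' : ℝ | ∃ z ∈ spectrum ℂ B, IsEigenvalueCondNumber B z c'} c

/-- The residual `b - B x`. -/
noncomputable def residual {n : ℕ} (B : Matrix (Fin n) (Fin n) ℂ)
    (b x : EuclideanSpace ℂ (Fin n)) : EuclideanSpace ℂ (Fin n) :=
  b - Matrix.toEuclideanLin B x

/-- The Krylov space `span {r, B r, …, B ^ (m - 1) r}` (the zero space for `m = 0`). -/
noncomputable def krylov {n : ℕ} (B : Matrix (Fin n) (Fin n) ℂ) (r : EuclideanSpace ℂ (Fin n))
    (m : ℕ) : Submodule ℂ (EuclideanSpace ℂ (Fin n)) :=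
  Submodule.span ℂ {y | ∃ i < m, y = Matrix.toEuclideanLin (B ^ i) r}

/-- `x` is the `m`-th GMRES iterate for `B x = b` with starting vector `x₀`: it lies in
`x₀ + krylov B r₀ m`, `r₀ = b - B x₀`, and minimises the Euclidean norm of the residual there. -/
def IsIterate {n : ℕ} (B : Matrix (Fin n) (Fin n) ℂ) (b x₀ : EuclideanSpace ℂ (Fin n))
    (m : ℕ) (x : EuclideanSpace ℂ (Fin n)) : Prop :=
  x - x₀ ∈ krylov B (residual B b x₀) m ∧
    ∀ y, y - x₀ ∈ krylov B (residual B b x₀) m → ‖residual B b x‖ ≤ ‖residual B b y‖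

/-- GMRES iterates exist, for every matrix and every `m`. -/
theorem exists_isIterate {n : ℕ} (B : Matrix (Fin n) (Fin n) ℂ) (b x₀ : EuclideanSpace ℂ (Fin n))
    (m : ℕ) : ∃ x, IsIterate B b x₀ m x := by
  let K := krylov B (residual B b x₀) m
  let W := K.map (Matrix.toEuclideanLin B)
  obtain ⟨w, hwW, hw⟩ := Submodule.exists_norm_eq_iInf_of_complete_subspace W
    W.complete_of_finiteDimensional (residual B b x₀)
  obtain ⟨k, hk, rfl⟩ := hwW
  have key : ∀ y, residual B b y = residual B b x₀ - Matrix.toEuclideanLin B (y - x₀) := by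
    intro y
    simp [residual]
  refine ⟨x₀ + k, by simpa using hk, fun y hy => ?_⟩
  rw [key (x₀ + k), key y, add_sub_cancel_left, hw]
  have hmem : Matrix.toEuclideanLin B (y - x₀) ∈ W := Submodule.mem_map_of_mem hy
  exact ciInf_le (f := fun w : (W : Set (EuclideanSpace ℂ (Fin n))) => ‖residual B b x₀ - w‖)
    ⟨0, by rintro _ ⟨_, rfl⟩; positivity⟩ ⟨_, hmem⟩

end GMRES

open scoped Matrix Matrix.Norms.L2Operator

/-! ### Laurent coefficients on circles and Carathéodory's coefficient bound. -/

namespace GMRES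

open Metric Complex

/-! The GMRES residual is at most `‖P(B) r₀‖` for every polynomial `P` of degree at most `m` with
`P(0) = 1` (`IsIterate.norm_residual_le`), so one good `P` suffices. Simple eigenvalues give an
eigenbasis, and `‖P(B) r₀‖ ≤ n κ M ‖r₀‖` if `|P| ≤ M` on the spectrum
(`HasSimpleEigenvalues.norm_aeval_le`). Take `P(z) = ∏ (1 - z/λ_j) · Q(z/R)` with `R = ‖B‖ + δ`: the
product kills the eigenvalues in `N`, and the others, divided by `R`, lie in the circular segment
`cos β < Re z`, `|z| < 1`.

`Q` is the Faber polynomial `F_k` of this segment divided by `F_k(0)`. Write the exterior conformal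
map as `ψ = segNum / segDen` in the variable `u = 1/w`. Then the `F_k(z)` are the Taylor
coefficients at `u = 0` of `G_z = faberGen β α θ z`.

For `z` in the segment, `G_z` is holomorphic in the unit disc, `G_z(0) = 1`, and `Re G_z ≥ 0` on the
unit circle; Carathéodory's bound gives `|F_k(z)| ≤ 2`. For the exterior point `0`, `G_0` has a
simple pole at `u = -γ`, because `ψ(-γ) = 0`. Subtracting the polar part and adding its reflection
in the unit circle leaves a holomorphic `H` with `Re H = Re G_0` on the circle. There `Re G_0 ≤ 2 Re
G_z`, so Carathéodory applied to `2 G_z - H` bounds the coefficients of `H` by `8`. Hence `|F_k(0)|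
≥ γ^(-k) - 9`, and `|Q| ≤ 12 γ^k` on the segment once `γ^k ≤ 1/12`
(`exists_polynomial_small_on_segment`). The hypothesis on `m` is the logarithm of the inequality
that then remains. -/

/-- The `k`-th Laurent coefficient of `f` on the circle of radius `r` around `0`. -/
noncomputable def circleCoeff (f : ℂ → ℂ) (k : ℕ) (r : ℝ) : ℂ :=
  Real.circleAverage (fun u => f u / u ^ k) 0 r

theorem continuousOn_div_pow_sphere {f : ℂ → ℂ} {r : ℝ} (hr : 0 < r)
    (hf : ContinuousOn f (sphere 0 r)) (k : ℕ) :
    ContinuousOn (fun u => f u / u ^ k) (sphere 0 r) := by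
  refine hf.div (by fun_prop) fun u hu => pow_ne_zero _ ?_
  rintro rfl
  simp at hu
  exact hr.ne hu

theorem circleIntegrable_div_pow {f : ℂ → ℂ} {r : ℝ} (hr : 0 < r)
    (hf : ContinuousOn f (sphere 0 r)) (k : ℕ) :
    CircleIntegrable (fun u => f u / u ^ k) 0 r :=
  (continuousOn_div_pow_sphere hr hf k).circleIntegrable hr.le

theorem circleCoeff_congr {f g : ℂ → ℂ} {r : ℝ} (hr : 0 < r) (h : Set.EqOn f g (sphere 0 r))
    (k : ℕ) : circleCoeff f k r = circleCoeff g k r := by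
  refine Real.circleAverage_congr_sphere fun u hu => ?_
  rw [abs_of_pos hr] at hu
  simp only [h hu]

theorem circleCoeff_add {f g : ℂ → ℂ} {r : ℝ} (hr : 0 < r) (hf : ContinuousOn f (sphere 0 r))
    (hg : ContinuousOn g (sphere 0 r)) (k : ℕ) :
    circleCoeff (fun u => f u + g u) k r = circleCoeff f k r + circleCoeff g k r := by
  unfold circleCoeff
  rw [← Real.circleAverage_fun_add (circleIntegrable_div_pow hr hf k)
    (circleIntegrable_div_pow hr hg k)]
  simp only [add_div]

theorem circleCoeff_const_mul (a : ℂ) (f : ℂ → ℂ) (k : ℕ) (r : ℝ) :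
    circleCoeff (fun u => a * f u) k r = a * circleCoeff f k r := by
  unfold circleCoeff
  rw [← smul_eq_mul, ← Real.circleAverage_fun_smul]
  simp only [smul_eq_mul, mul_div_assoc]

theorem circleCoeff_mul_pow_of_le {f : ℂ → ℂ} {r : ℝ} (hr : 0 < r) {j k : ℕ} (hjk : j ≤ k) :
    circleCoeff (fun u => u ^ j * f u) k r = circleCoeff f (k - j) r := by
  refine Real.circleAverage_congr_sphere fun u hu => ?_
  have hu0 : u ≠ 0 := by
    rintro rfl
    rw [mem_sphere_zero_iff_norm, norm_zero] at hu
    exact hr.ne' (abs_eq_zero.mp hu.symm)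
  obtain ⟨i, rfl⟩ := Nat.exists_eq_add_of_le hjk
  simp only [Nat.add_sub_cancel_left, pow_add]
  field_simp

theorem circleCoeff_zero {f : ℂ → ℂ} {r : ℝ} (hr : 0 < r) (hf : DiffContOnCl ℂ f (ball 0 r)) :
    circleCoeff f 0 r = f 0 := by
  have := DiffContOnCl.circleAverage (f := f) (c := 0) (R := r) (by rwa [abs_of_pos hr])
  simpa [circleCoeff] using this

theorem circleCoeff_mul_pow_eq_zero {f : ℂ → ℂ} {r : ℝ} (hr : 0 < r)
    (hf : DiffContOnCl ℂ f (ball 0 r)) (k : ℕ) :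
    circleCoeff (fun u => u ^ (k + 1) * f u) k r = 0 := by
  have h : circleCoeff (fun u => u ^ (k + 1) * f u) k r = circleCoeff (fun u => u * f u) 0 r := by
    have := circleCoeff_mul_pow_of_le (f := fun u => u * f u) hr (le_refl k)
    rw [Nat.sub_self] at this
    rw [← this]
    congr 1
    ext u
    ring
  rw [h, circleCoeff_zero hr]
  · simp
  · exact (differentiable_id.diffContOnCl).smul hf

/-- The coefficients do not depend on the circle. -/
theorem circleCoeff_eq_of_le {f : ℂ → ℂ} {r R : ℝ} (hr : 0 < r) (hrR : r ≤ R)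
    (hf : DiffContOnCl ℂ f (ball 0 R)) (k : ℕ) : circleCoeff f k R = circleCoeff f k r := by
  unfold circleCoeff
  have hR := hr.trans_le hrR
  rw [Real.circleAverage_eq_circleIntegral hR.ne', Real.circleAverage_eq_circleIntegral hr.ne']
  congr 1
  have hcont : ContinuousOn f (closedBall 0 R) := hf.continuousOn_ball
  refine circleIntegral_eq_of_differentiable_on_annulus_off_countable hr hrR
    (s := ∅) Set.countable_empty ?_ ?_
  · have : ∀ u ∈ closedBall (0 : ℂ) R \ ball 0 r, u ≠ 0 := by
      rintro u hu rfl
      exact hu.2 (by simpa using hr)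
    refine ContinuousOn.smul (ContinuousOn.inv₀ (f := fun u : ℂ => u - 0) (by fun_prop)
      (fun u hu => by simpa using this u hu)) ?_
    exact (hcont.mono Set.sdiff_subset).div (by fun_prop) fun u hu => pow_ne_zero _ (this u hu)
  · rintro u ⟨⟨hu, hu'⟩, -⟩
    have hu0 : u ≠ 0 := by
      rintro rfl
      exact hu' (by simpa using hr.le)
    have hfu : DifferentiableAt ℂ f u := hf.differentiableAt isOpen_ball hu
    refine DifferentiableAt.smul (DifferentiableAt.inv (h := fun u : ℂ => u - 0) (by fun_prop)
      (by simpa using hu0)) ?_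
    exact hfu.div (by fun_prop) (pow_ne_zero _ hu0)

/-- Carathéodory's coefficient bound for functions with non-negative real part. -/
theorem norm_circleCoeff_le_of_re_nonneg {f : ℂ → ℂ} (hf : DiffContOnCl ℂ f (ball 0 1))
    (hre : ∀ u ∈ sphere (0 : ℂ) 1, 0 ≤ (f u).re) {k : ℕ} (hk : 1 ≤ k) :
    ‖circleCoeff f k 1‖ ≤ 2 * (f 0).re := by
  have hcont : ContinuousOn f (sphere 0 1) := hf.continuousOn_ball.mono sphere_subset_closedBall
  -- On the unit circle this average is the conjugate of the mean of `u ^ k * f u`, which vanishes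
  -- at the centre. Adding it replaces `f` by `2 Re f` in the coefficient, and `2 Re f` equals its
  -- own modulus.
  have hconj : Real.circleAverage (fun u => (starRingEnd ℂ) (f u) / u ^ k) 0 1 = 0 := by
    have h1 : Real.circleAverage (fun u => u ^ k * f u) 0 1 = 0 := by
      have := DiffContOnCl.circleAverage (f := fun u => u ^ k * f u) (c := 0) (R := 1)
        (by rw [abs_one]; exact ((differentiable_id.pow k).diffContOnCl).smul hf)
      rw [this]
      simp [show k ≠ 0 by lia]
    have h2 := ContinuousLinearMap.circleAverage_comp_comm
      (Complex.conjCLE : ℂ ≃L[ℝ] ℂ).toContinuousLinearMap (f := fun u => u ^ k * f u)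
      (c := 0) (R := 1)
      (ContinuousOn.circleIntegrable zero_le_one
        ((continuous_id.pow k).continuousOn.mul hcont))
    rw [h1, map_zero] at h2
    refine Eq.trans ?_ h2
    refine Real.circleAverage_congr_sphere fun u hu => ?_
    have hu1 : ‖u‖ = 1 := by simpa using hu
    have : (starRingEnd ℂ) u = u⁻¹ := by
      rw [Complex.inv_def, Complex.normSq_eq_norm_sq, hu1]; simp
    simp [this, div_eq_inv_mul]
  have hint : CircleIntegrable (fun u => (starRingEnd ℂ) (f u) / u ^ k) 0 1 :=
    circleIntegrable_div_pow one_pos (Complex.continuous_conj.comp_continuousOn hcont) k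
  have hsum : circleCoeff f k 1 =
      Real.circleAverage (fun u => ((2 * (f u).re : ℝ) : ℂ) / u ^ k) 0 1 := by
    rw [← add_zero (circleCoeff f k 1)]
    nth_rw 1 [← hconj]
    rw [circleCoeff,
      ← Real.circleAverage_fun_add (circleIntegrable_div_pow one_pos hcont k) hint]
    congr 1
    ext u
    rw [← add_div, Complex.add_conj]
  have hmean : Real.circleAverage (fun u => (f u).re) 0 1 = (f 0).re := by
    have h := ContinuousLinearMap.circleAverage_comp_comm Complex.reCLM (f := f) (c := 0) (R := 1)
      (hcont.circleIntegrable zero_le_one)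
    rw [DiffContOnCl.circleAverage (by rwa [abs_one])] at h
    exact h
  rw [hsum, ← hmean, ← smul_eq_mul, ← Real.circleAverage_fun_smul]
  unfold Real.circleAverage
  rw [norm_smul, smul_eq_mul, Real.norm_of_nonneg (by positivity)]
  refine mul_le_mul_of_nonneg_left ?_ (by positivity)
  refine (intervalIntegral.norm_integral_le_integral_norm Real.two_pi_pos.le).trans (le_of_eq ?_)
  refine intervalIntegral.integral_congr fun t _ => ?_
  have := hre (circleMap 0 1 t) (circleMap_mem_sphere _ zero_le_one _)
  simp only [norm_div, norm_pow, norm_circleMap_zero, abs_one, one_pow, div_one, smul_eq_mul,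
    Complex.norm_real, Real.norm_eq_abs]
  exact abs_of_nonneg (by positivity)

/-- The coefficients of `g u / (1 - z * u * h u)` are polynomials in `z`. -/
theorem exists_polynomial_eval_eq_circleCoeff {g h : ℂ → ℂ} {r : ℝ} (hr : 0 < r)
    (hg : DiffContOnCl ℂ g (ball 0 r)) (hh : DiffContOnCl ℂ h (ball 0 r)) (k : ℕ) :
    ∃ P : Polynomial ℂ, P.natDegree ≤ k ∧
      ∀ z : ℂ, (∀ u ∈ closedBall (0 : ℂ) r, 1 - z * (u * h u) ≠ 0) →
        P.eval z = circleCoeff (fun u => g u / (1 - z * (u * h u))) k r := by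
  have hpow : ∀ j : ℕ, DiffContOnCl ℂ (fun u => g u * h u ^ j) (ball 0 r) := by
    intro j
    induction j with
    | zero => simpa using hg
    | succ j ih => simpa [pow_succ, mul_assoc] using ih.smul hh
  have hcl : closure (ball (0 : ℂ) r) = closedBall 0 r := closure_ball _ hr.ne'
  have hsph : ∀ {f : ℂ → ℂ}, DiffContOnCl ℂ f (ball 0 r) → ContinuousOn f (sphere 0 r) :=
    fun hf => hf.continuousOn_ball.mono sphere_subset_closedBall
  refine ⟨∑ j ∈ Finset.range (k + 1),
    Polynomial.C (circleCoeff (fun u => g u * h u ^ j) (k - j) r) * Polynomial.X ^ j, ?_, ?_⟩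
  · refine Polynomial.natDegree_sum_le_of_forall_le _ _ fun j hj => ?_
    exact (Polynomial.natDegree_C_mul_X_pow_le _ _).trans (by simpa [Nat.lt_succ_iff] using hj)
  intro z hz
  have hden : DiffContOnCl ℂ (fun u => (1 - z * (u * h u))⁻¹) (ball 0 r) := by
    have h1 : DiffContOnCl ℂ (fun u => 1 - z * (u * h u)) (ball 0 r) :=
      ((differentiable_id.diffContOnCl.smul hh).const_smul z).const_sub 1
    exact h1.inv (by rw [hcl]; exact hz)
  -- Truncated geometric series in `z * u * h u`. At `i = k + 1` the remainder carries the factor `u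
  -- ^ (k + 1)` and has no `k`-th coefficient.
  have key : ∀ i ≤ k + 1, circleCoeff (fun u => g u / (1 - z * (u * h u))) k r =
      ∑ j ∈ Finset.range i, circleCoeff (fun u => g u * h u ^ j) (k - j) r * z ^ j +
        circleCoeff (fun u => z ^ i *
          (u ^ i * ((g u * h u ^ i) * (1 - z * (u * h u))⁻¹))) k r := by
    intro i hi
    induction i with
    | zero => simp [div_eq_mul_inv]
    | succ i ih =>
      rw [ih (by lia), Finset.sum_range_succ, add_assoc]
      congr 1
      rw [← circleCoeff_mul_pow_of_le hr (by lia : i ≤ k), mul_comm _ (z ^ i),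
        ← circleCoeff_const_mul, ← circleCoeff_add hr]
      · refine circleCoeff_congr hr (fun u hu => ?_) _
        have hinv := mul_inv_cancel₀ (hz u (sphere_subset_closedBall hu))
        linear_combination (z ^ i * u ^ i * g u * h u ^ i) * hinv
      · have := hsph (hpow i)
        fun_prop
      · have h1 := hsph (hpow (i + 1))
        have h2 := hsph hden
        fun_prop
  rw [key (k + 1) le_rfl, circleCoeff_const_mul, circleCoeff_mul_pow_eq_zero hr]
  · simp [Polynomial.eval_finsetSum]
  · exact (hpow (k + 1)).smul hden

/-- On the unit circle the inversion `u ↦ 1/u` turns `1 / u ^ k` into `u ^ k`, whose mean is its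
value at `0`. Other radii reduce to this one inside a common disc. -/
theorem circleCoeff_one_eq_zero {r : ℝ} (hr : 0 < r) {k : ℕ} (hk : 1 ≤ k) :
    circleCoeff (fun _ => 1) k r = 0 := by
  have hmax : r ≤ max r 1 := le_max_left _ _
  have hd : DiffContOnCl ℂ (fun _ : ℂ => (1 : ℂ)) (ball 0 (max r 1)) := diffContOnCl_const
  rw [← circleCoeff_eq_of_le hr hmax hd, circleCoeff_eq_of_le one_pos (le_max_right _ _) hd]
  have h := Real.circleAverage_zero_one_congr_inv (f := fun u : ℂ => u ^ k)
  have h1 := DiffContOnCl.circleAverage (f := fun u : ℂ => u ^ k) (c := 0) (R := 1)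
        ((differentiable_id.pow k).diffContOnCl)
  rw [h1] at h
  simpa [circleCoeff, show k ≠ 0 by lia] using h

theorem circleCoeff_one_sub_inv {a : ℂ} {r : ℝ} (hr : 0 < r) (ha : ‖a‖ * r < 1) (k : ℕ) :
    circleCoeff (fun u => (1 - a * u)⁻¹) k r = a ^ k := by
  have hne : ∀ u ∈ closedBall (0 : ℂ) r, 1 - a * u ≠ 0 := by
    intro u hu h
    have h1 : ‖a * u‖ = 1 := by rw [← sub_eq_zero.mp h, norm_one]
    rw [norm_mul] at h1
    have : ‖u‖ ≤ r := by simpa using hu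
    nlinarith [norm_nonneg a]
  have hd : DiffContOnCl ℂ (fun u => (1 - a * u)⁻¹) (ball 0 r) := by
    refine DiffContOnCl.inv ((Differentiable.diffContOnCl (by fun_prop))) ?_
    rwa [closure_ball _ hr.ne']
  induction k with
  | zero => rw [circleCoeff_zero hr hd]; simp
  | succ k ih =>
    have h : circleCoeff (fun u => (1 - a * u)⁻¹) (k + 1) r =
        circleCoeff (fun u => 1 + a * (u ^ 1 * (1 - a * u)⁻¹)) (k + 1) r := by
      refine circleCoeff_congr hr (fun u hu => ?_) _
      have := hne u (sphere_subset_closedBall hu)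
      field_simp
      ring
    have hc : ContinuousOn (fun u => (1 - a * u)⁻¹) (sphere 0 r) :=
      hd.continuousOn_ball.mono sphere_subset_closedBall
    rw [h, circleCoeff_add hr (by fun_prop) (by fun_prop), circleCoeff_const_mul,
      circleCoeff_mul_pow_of_le hr (by lia), circleCoeff_one_eq_zero hr (by lia),
      Nat.add_sub_cancel, ih]
    ring

end GMRES

/-! ### Angles of the segment and the corner factors. -/

namespace GMRES

open Metric Complex

/-- The angles that belong to the circular segment `{cos β ≤ Re z, ‖z‖ ≤ 1}`: the outer angle at
the corners is `α π`, and the corners correspond to the points `exp (± θ i)` of the unit circle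
under the exterior conformal map. -/
structure IsSegmentAngles (β α θ : ℝ) : Prop where
  pos : 0 < β
  lt : β < Real.pi / 2
  alpha_mul_pi : α * Real.pi = 2 * Real.pi - β
  alpha_mul_theta : α * θ = Real.pi

namespace IsSegmentAngles

variable {β α θ : ℝ}

theorem three_half_lt (h : IsSegmentAngles β α θ) : 3 / 2 < α := by
  have := h.alpha_mul_pi; have := h.lt; have := Real.pi_pos
  nlinarith

theorem lt_two (h : IsSegmentAngles β α θ) : α < 2 := by
  have := h.alpha_mul_pi; have := h.pos; have := Real.pi_pos
  nlinarith

theorem theta_gt (h : IsSegmentAngles β α θ) : Real.pi / 2 < θ := by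
  have := h.alpha_mul_theta; have := h.lt_two; have := h.three_half_lt; have := Real.pi_pos
  by_contra! hc
  nlinarith

theorem theta_lt (h : IsSegmentAngles β α θ) : θ < 2 * Real.pi / 3 := by
  have := h.alpha_mul_theta; have := h.three_half_lt; have := Real.pi_pos
  by_contra! hc
  nlinarith

theorem sin_theta_pos (h : IsSegmentAngles β α θ) : 0 < Real.sin θ :=
  Real.sin_pos_of_pos_of_lt_pi (by linarith [h.theta_gt, Real.pi_pos])
    (by linarith [h.theta_lt, Real.pi_pos])

theorem sin_pos (h : IsSegmentAngles β α θ) : 0 < Real.sin β :=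
  Real.sin_pos_of_pos_of_lt_pi h.pos (by linarith [h.lt, Real.pi_pos])

theorem cos_pos (h : IsSegmentAngles β α θ) : 0 < Real.cos β :=
  Real.cos_pos_of_mem_Ioo ⟨by linarith [h.pos, Real.pi_pos], h.lt⟩

end IsSegmentAngles

/-- The linear function `1 - exp (φ i) u`. -/
noncomputable def cornerFactor (φ : ℝ) (u : ℂ) : ℂ := 1 - exp (φ * I) * u

theorem cornerFactor_zero (φ : ℝ) : cornerFactor φ 0 = 1 := by simp [cornerFactor]

/-- This keeps the corner factors off the branch cut, so principal powers and logarithms can be used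
on the whole closed disc. -/
theorem cornerFactor_re_pos_or_eq_zero (φ : ℝ) {u : ℂ} (hu : ‖u‖ ≤ 1) :
    0 < (cornerFactor φ u).re ∨ cornerFactor φ u = 0 := by
  have hv : ‖exp (φ * I) * u‖ ≤ 1 := by rwa [norm_mul, norm_exp_ofReal_mul_I, one_mul]
  unfold cornerFactor
  set v := exp (φ * I) * u
  rcases eq_or_ne v 1 with h | h
  · right; rw [h, sub_self]
  left
  have h1 : v.re ^ 2 + v.im ^ 2 ≤ 1 := by
    have := Complex.sq_norm v
    rw [Complex.normSq_apply] at this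
    nlinarith [norm_nonneg v]
  simp only [sub_re, one_re, sub_pos]
  by_contra! hc
  have h2 : v.im = 0 := by nlinarith
  have h3 : v.re = 1 := by nlinarith
  exact h (Complex.ext (by simp [h3]) (by simp [h2]))

theorem cornerFactor_re_pos (φ : ℝ) {u : ℂ} (hu : ‖u‖ < 1) : 0 < (cornerFactor φ u).re := by
  refine (cornerFactor_re_pos_or_eq_zero φ hu.le).resolve_right fun h => ?_
  have : ‖exp (φ * I) * u‖ = 1 := by rw [← sub_eq_zero.mp h, norm_one]
  rw [norm_mul, norm_exp_ofReal_mul_I, one_mul] at this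
  exact hu.ne this

theorem continuous_cornerFactor (φ : ℝ) : Continuous (cornerFactor φ) := by
  unfold cornerFactor; fun_prop

theorem hasDerivAt_cornerFactor (φ : ℝ) (u : ℂ) :
    HasDerivAt (cornerFactor φ) (-exp (φ * I)) u := by
  have h := ((hasDerivAt_id u).const_mul (exp (φ * I))).const_sub 1
  rw [mul_one] at h
  exact h

theorem hasDerivAt_cornerFactor_cpow (φ : ℝ) (s : ℂ) {u : ℂ} (hu : ‖u‖ < 1) :
    HasDerivAt (fun u => cornerFactor φ u ^ s)
      (s * cornerFactor φ u ^ (s - 1) * -exp (φ * I)) u :=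
  (hasDerivAt_cornerFactor φ u).cpow_const (Or.inl (cornerFactor_re_pos φ hu))

/-- The only doubtful boundary point is the zero of the factor; a power with positive real exponent
is still continuous there. -/
theorem diffContOnCl_cornerFactor_cpow (φ : ℝ) {s : ℂ} (hs : 0 < s.re) :
    DiffContOnCl ℂ (fun u => cornerFactor φ u ^ s) (ball 0 1) := by
  constructor
  · intro u hu
    exact (hasDerivAt_cornerFactor_cpow φ s (by simpa using hu)).differentiableAt
      |>.differentiableWithinAt
  · rw [closure_ball _ one_ne_zero]
    intro u hu
    refine ContinuousAt.continuousWithinAt ?_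
    rcases cornerFactor_re_pos_or_eq_zero φ (u := u) (by simpa using hu) with h | h
    · exact (continuous_cornerFactor φ).continuousAt.cpow continuousAt_const (Or.inl h)
    · have h1 := continuousAt_cpow_zero_of_re_pos hs
      rw [← h] at h1
      exact ContinuousAt.comp (f := fun u => (cornerFactor φ u, s)) h1
        ((continuous_cornerFactor φ).continuousAt.prodMk continuousAt_const)

theorem cornerFactor_sub (θ : ℝ) (u : ℂ) :
    cornerFactor (-θ) u - cornerFactor θ u = 2 * I * Real.sin θ * u := by
  simp only [cornerFactor, exp_mul_I, ← ofReal_cos, ← ofReal_sin, Real.cos_neg, Real.sin_neg]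
  push_cast
  ring

theorem cornerFactor_mul (θ : ℝ) (u : ℂ) :
    cornerFactor θ u * cornerFactor (-θ) u = 1 - 2 * Real.cos θ * u + u ^ 2 := by
  have h : (Real.cos θ : ℂ) ^ 2 + (Real.sin θ : ℂ) ^ 2 = 1 := by
    exact_mod_cast Real.cos_sq_add_sin_sq θ
  simp only [cornerFactor, exp_mul_I, ← ofReal_cos, ← ofReal_sin, Real.cos_neg, Real.sin_neg]
  rw [ofReal_neg]
  linear_combination u ^ 2 * h - (Real.sin θ : ℂ) ^ 2 * u ^ 2 * I_sq

/-- The argument of the quotient of the two factors, turned by `-θ`, is read off from the right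
side: the sign of the imaginary part locates the disc, and on the circle the real part tells the two
arcs apart. -/
theorem cornerFactor_mul_conj (θ : ℝ) (u : ℂ) :
    cornerFactor θ u * (starRingEnd ℂ) (cornerFactor (-θ) u) * exp (-θ * I) =
      ⟨Real.cos θ * (1 + ‖u‖ ^ 2) - 2 * u.re, Real.sin θ * (‖u‖ ^ 2 - 1)⟩ := by
  have h := Real.cos_sq_add_sin_sq θ
  have hu : ‖u‖ ^ 2 = u.re ^ 2 + u.im ^ 2 := by
    rw [Complex.sq_norm, Complex.normSq_apply]; ring
  have h1 : ∀ φ : ℝ, exp (φ * I) = ⟨Real.cos φ, Real.sin φ⟩ := fun φ =>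
    Complex.ext (exp_ofReal_mul_I_re φ) (exp_ofReal_mul_I_im φ)
  rw [hu, ← ofReal_neg, cornerFactor, cornerFactor, h1, h1, Real.cos_neg, Real.sin_neg]
  apply Complex.ext
  · simp
    linear_combination (u.re ^ 2 * Real.cos θ + u.im ^ 2 * Real.cos θ - 2 * u.re) * h
  · simp
    linear_combination (u.re ^ 2 * Real.sin θ + u.im ^ 2 * Real.sin θ) * h

/-- In the closed unit disc the quotient of the corner factors lies in a half plane. -/
theorem exists_polar_cornerFactor {β α θ : ℝ} (h : IsSegmentAngles β α θ) {u : ℂ} (hu : ‖u‖ ≤ 1)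
    (ha : cornerFactor θ u ≠ 0) (hb : cornerFactor (-θ) u ≠ 0) :
    ∃ ρ ω : ℝ, 0 < ρ ∧ θ - Real.pi ≤ ω ∧ ω ≤ θ ∧
      cornerFactor θ u = ρ * exp (ω * I) * cornerFactor (-θ) u ∧
      cornerFactor θ u ^ (α : ℂ) =
        ((ρ ^ α : ℝ) : ℂ) * exp ((α * ω : ℝ) * I) * cornerFactor (-θ) u ^ (α : ℂ) ∧
      (‖u‖ = 1 → (ω = θ ∧ u.re ≤ Real.cos θ) ∨ (ω = θ - Real.pi ∧ Real.cos θ ≤ u.re)) := by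
  have hare := (cornerFactor_re_pos_or_eq_zero θ hu).resolve_right ha
  have hbre := (cornerFactor_re_pos_or_eq_zero (-θ) hu).resolve_right hb
  have hkey := cornerFactor_mul_conj θ u
  set a := cornerFactor θ u
  set b := cornerFactor (-θ) u
  have hna : 0 < ‖a‖ := norm_pos_iff.mpr ha
  have hnb : 0 < ‖b‖ := norm_pos_iff.mpr hb
  have haarg := abs_lt.mp (abs_arg_lt_pi_div_two_iff.mpr (Or.inl hare))
  have hbarg := abs_lt.mp (abs_arg_lt_pi_div_two_iff.mpr (Or.inl hbre))
  have hab : a = ((‖a‖ / ‖b‖ : ℝ) : ℂ) * exp ((arg a - arg b : ℝ) * I) * b := by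
    have hbb : (‖b‖ : ℂ) ≠ 0 := by exact_mod_cast hnb.ne'
    have : exp (arg a * I) = exp ((arg a - arg b : ℝ) * I) * exp (arg b * I) := by
      rw [← exp_add]; push_cast; ring_nf
    calc a = ‖a‖ * exp (arg a * I) := (norm_mul_exp_arg_mul_I a).symm
      _ = ((‖a‖ / ‖b‖ : ℝ) : ℂ) * exp ((arg a - arg b : ℝ) * I) *
          (‖b‖ * exp (arg b * I)) := by rw [this, ofReal_div]; field_simp
      _ = _ := by rw [norm_mul_exp_arg_mul_I]
  set ω := arg a - arg b
  set ρ := ‖a‖ / ‖b‖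
  have hρ : 0 < ρ := div_pos hna hnb
  have hpol : ((ρ * ‖b‖ ^ 2 : ℝ) : ℂ) * exp ((ω - θ : ℝ) * I) =
      ⟨Real.cos θ * (1 + ‖u‖ ^ 2) - 2 * u.re, Real.sin θ * (‖u‖ ^ 2 - 1)⟩ := by
    rw [← hkey]
    have h1 : b * (starRingEnd ℂ) b = ((‖b‖ ^ 2 : ℝ) : ℂ) := by
      rw [Complex.mul_conj, Complex.normSq_eq_norm_sq]
    have h2 : exp ((ω - θ : ℝ) * I) = exp (ω * I) * exp (-θ * I) := by
      rw [← exp_add]; push_cast; ring_nf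
    rw [h2, ofReal_mul, ← h1]
    conv_rhs => rw [hab]
    ring
  have hre : ρ * ‖b‖ ^ 2 * Real.cos (ω - θ) = Real.cos θ * (1 + ‖u‖ ^ 2) - 2 * u.re := by
    have := congrArg re hpol
    rwa [re_ofReal_mul, exp_ofReal_mul_I_re] at this
  have him : ρ * ‖b‖ ^ 2 * Real.sin (ω - θ) = Real.sin θ * (‖u‖ ^ 2 - 1) := by
    have := congrArg im hpol
    rwa [im_ofReal_mul, exp_ofReal_mul_I_im] at this
  have hpos : 0 < ρ * ‖b‖ ^ 2 := by positivity
  have hsθ := h.sin_theta_pos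
  -- Both arguments lie in `(-π/2, π/2)`, so `|ω| < π`; with this sign only `[θ - π, θ]` is left.
  have hsin : Real.sin (ω - θ) ≤ 0 := by
    have h1 : ρ * ‖b‖ ^ 2 * Real.sin (ω - θ) ≤ 0 := by
      rw [him]
      exact mul_nonpos_of_nonneg_of_nonpos hsθ.le (by nlinarith [norm_nonneg u])
    by_contra! hc
    exact absurd h1 (not_le.mpr (mul_pos hpos hc))
  have hθ1 := h.theta_gt
  have hθ2 := h.theta_lt
  have hlow : θ - Real.pi ≤ ω := by
    by_contra! hc
    have : 0 < Real.sin (ω - θ + 2 * Real.pi) :=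
      Real.sin_pos_of_pos_of_lt_pi (by linarith) (by linarith)
    rw [Real.sin_add_two_pi] at this
    linarith
  have hup : ω ≤ θ := by
    by_contra! hc
    have := Real.sin_pos_of_pos_of_lt_pi (x := ω - θ) (by linarith) (by linarith)
    linarith
  refine ⟨ρ, ω, hρ, hlow, hup, hab, ?_, fun hu1 => ?_⟩
  -- As `ω` is the difference of the principal arguments themselves, no multiple of `2π` enters the
  -- powers.
  · rw [cpow_def_of_ne_zero ha, cpow_def_of_ne_zero hb, Real.rpow_def_of_pos hρ, ofReal_exp,
      ← exp_add, ← exp_add]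
    congr 1
    have hlog : Real.log ρ = Real.log ‖a‖ - Real.log ‖b‖ := Real.log_div hna.ne' hnb.ne'
    rw [hlog]
    simp only [Complex.log, ω]
    push_cast
    ring
  · rw [hu1] at hre him
    have hs0 : Real.sin (ω - θ) = 0 := by
      have : ρ * ‖b‖ ^ 2 * Real.sin (ω - θ) = 0 := by rw [him]; ring
      exact (mul_eq_zero.mp this).resolve_left hpos.ne'
    rcases eq_or_lt_of_le hup with h1 | h1
    · left
      refine ⟨h1, ?_⟩
      rw [h1, sub_self, Real.cos_zero] at hre
      linarith
    · right
      have h2 : ω = θ - Real.pi := by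
        rcases eq_or_lt_of_le hlow with h3 | h3
        · exact h3.symm
        · have := Real.sin_neg_of_neg_of_neg_pi_lt (x := ω - θ) (by linarith) (by linarith)
          linarith
      refine ⟨h2, ?_⟩
      rw [h2, show θ - Real.pi - θ = -Real.pi by ring, Real.cos_neg, Real.cos_pi] at hre
      linarith

end GMRES

/-! ### The exterior conformal map and the generating function of the Faber polynomials. -/

namespace GMRES

open Metric Complex

/-- Denominator of the exterior conformal map `segNum / segDen` of the circular segment, in the
variable `u = 1 / w`. -/
noncomputable def segDen (α θ : ℝ) (u : ℂ) : ℂ :=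
  cornerFactor θ u ^ (α : ℂ) - cornerFactor (-θ) u ^ (α : ℂ)

/-- Numerator of the exterior conformal map of the circular segment. -/
noncomputable def segNum (β α θ : ℝ) (u : ℂ) : ℂ :=
  cornerFactor θ u ^ (α : ℂ) * exp ((-β : ℝ) * I) - cornerFactor (-θ) u ^ (α : ℂ) * exp (β * I)

/-- The Wronskian of `segNum` and `segDen`. -/
noncomputable def segWronskian (β α θ : ℝ) (u : ℂ) : ℂ :=
  4 * α * Real.sin θ * Real.sin β *
    (cornerFactor θ u ^ ((α : ℂ) - 1) * cornerFactor (-θ) u ^ ((α : ℂ) - 1))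

/-- The generating function of the Faber polynomials of the circular segment at `z`. -/
noncomputable def faberGen (β α θ : ℝ) (z u : ℂ) : ℂ :=
  segWronskian β α θ u / (dslope (segDen α θ) 0 u * (z * segDen α θ u - segNum β α θ u))

variable {β α θ : ℝ}

theorem segDen_zero : segDen α θ 0 = 0 := by simp [segDen, cornerFactor_zero]

theorem segNum_zero : segNum β α θ 0 = -2 * I * Real.sin β := by
  simp only [segNum, cornerFactor_zero, exp_mul_I, ← ofReal_cos, ← ofReal_sin, Real.cos_neg,
    Real.sin_neg, one_cpow]
  push_cast
  ring

theorem mul_dslope_segDen (u : ℂ) : u * dslope (segDen α θ) 0 u = segDen α θ u := by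
  have := sub_smul_dslope (segDen α θ) 0 u
  simpa [segDen_zero] using this

theorem eq_one_and_eq_of_mul_exp_eq_exp {r x y : ℝ} (hr : 0 < r)
    (hxy : |x - y| < 2 * Real.pi) (heq : (r : ℂ) * exp (x * I) = exp (y * I)) :
    r = 1 ∧ x = y := by
  have h1 : r = 1 := by
    have := congrArg norm heq
    rwa [norm_mul, norm_exp_ofReal_mul_I, norm_exp_ofReal_mul_I, mul_one, norm_real,
      Real.norm_of_nonneg hr.le] at this
  refine ⟨h1, ?_⟩
  rw [h1, ofReal_one, one_mul] at heq
  have h2 : exp ((x - y : ℝ) * I) = 1 := by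
    rw [ofReal_sub, sub_mul, exp_sub, heq, div_self (exp_ne_zero _)]
  have h3 := congrArg re h2
  rw [exp_ofReal_mul_I_re, one_re] at h3
  have h4 := abs_lt.mp hxy
  linarith [(Real.cos_eq_one_iff_of_lt_of_lt (by linarith) (by linarith)).mp h3]

namespace IsSegmentAngles

/-- The difference of the two factors is `2i sin θ · u`, and at `u = 0` both are `1`. -/
theorem cornerFactor_ne_zero_or (h : IsSegmentAngles β α θ) (u : ℂ) :
    cornerFactor θ u ≠ 0 ∨ cornerFactor (-θ) u ≠ 0 := by
  by_contra! hc
  have h1 := cornerFactor_sub θ u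
  rw [hc.1, hc.2, sub_self] at h1
  have h2 : (Real.sin θ : ℂ) ≠ 0 := by exact_mod_cast h.sin_theta_pos.ne'
  have h3 : u = 0 := by simpa [h2, -ofReal_sin] using h1.symm
  simp [h3, cornerFactor_zero] at hc

theorem alpha_ne_zero (h : IsSegmentAngles β α θ) : (α : ℂ) ≠ 0 := by
  exact_mod_cast (by linarith [h.three_half_lt] : (0 : ℝ) < α).ne'

theorem cpow_eq_zero_iff (h : IsSegmentAngles β α θ) (x : ℂ) : x ^ (α : ℂ) = 0 ↔ x = 0 := by
  simp [Complex.cpow_eq_zero_iff, h.alpha_ne_zero]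

theorem alpha_mul_mem (h : IsSegmentAngles β α θ) {ω : ℝ} (h1 : θ - Real.pi ≤ ω) (h2 : ω ≤ θ) :
    β - Real.pi ≤ α * ω ∧ α * ω ≤ Real.pi := by
  have := h.three_half_lt; have := h.alpha_mul_pi; have := h.alpha_mul_theta
  constructor <;> nlinarith

/-- The closed unit disc in the variable `u = 1 / w` is mapped outside of the sector which belongs
to the interior of the segment. -/
theorem exists_polar_of_cpow_mul_eq (h : IsSegmentAngles β α θ) {u : ℂ} (hu : ‖u‖ ≤ 1) {p q : ℂ}
    (hp : p ≠ 0) (hq : q ≠ 0)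
    (hpq : cornerFactor θ u ^ (α : ℂ) * p = cornerFactor (-θ) u ^ (α : ℂ) * q) :
    ∃ ρ ω : ℝ, 0 < ρ ∧ β - Real.pi ≤ α * ω ∧ α * ω ≤ Real.pi ∧
      cornerFactor θ u = ρ * exp (ω * I) * cornerFactor (-θ) u ∧
      ((ρ ^ α : ℝ) : ℂ) * exp ((α * ω : ℝ) * I) * p = q := by
  have hab : cornerFactor θ u ≠ 0 ∧ cornerFactor (-θ) u ≠ 0 := by
    constructor
    · intro h0
      have h1 := (h.cornerFactor_ne_zero_or u).resolve_left (not_not.mpr h0)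
      rw [h0, zero_cpow h.alpha_ne_zero, zero_mul, zero_eq_mul, h.cpow_eq_zero_iff] at hpq
      exact hpq.elim h1 hq
    · intro h0
      have h1 := (h.cornerFactor_ne_zero_or u).resolve_right (not_not.mpr h0)
      rw [h0, zero_cpow h.alpha_ne_zero, zero_mul, mul_eq_zero, h.cpow_eq_zero_iff] at hpq
      exact hpq.elim h1 hp
  obtain ⟨ρ, ω, hρ, h1, h2, h3, h4, -⟩ := exists_polar_cornerFactor h hu hab.1 hab.2
  refine ⟨ρ, ω, hρ, (h.alpha_mul_mem h1 h2).1, (h.alpha_mul_mem h1 h2).2, h3, ?_⟩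
  have hB : cornerFactor (-θ) u ^ (α : ℂ) ≠ 0 := by
    rw [Ne, h.cpow_eq_zero_iff]; exact hab.2
  rw [h4] at hpq
  refine mul_left_cancel₀ hB ?_
  linear_combination hpq

theorem eq_one_and_eq_of_mul_exp_eq (h : IsSegmentAngles β α θ) {ρ x y : ℝ} (hρ : 0 < ρ)
    (hxy : |x - y| < 2 * Real.pi)
    (heq : ((ρ ^ α : ℝ) : ℂ) * exp (x * I) = exp (y * I)) : ρ = 1 ∧ x = y := by
  have hα : 0 < α := by linarith [h.three_half_lt]
  obtain ⟨h1, h2⟩ := eq_one_and_eq_of_mul_exp_eq_exp (Real.rpow_pos_of_pos hρ α) hxy heq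
  exact ⟨(Real.rpow_left_inj hρ.le zero_le_one hα.ne').mp (by rw [h1, Real.one_rpow]), h2⟩

/-- The map takes the value `∞` only at `u = 0`: a zero of the denominator forces `αω = 0`, since
`αω` is confined to `[β - π, π]`, and then the two corner factors agree. -/
theorem segDen_ne_zero (h : IsSegmentAngles β α θ) {u : ℂ} (hu : ‖u‖ ≤ 1) (hu0 : u ≠ 0) :
    segDen α θ u ≠ 0 := by
  intro h0
  obtain ⟨ρ, ω, hρ, h1, h2, h3, h4⟩ := h.exists_polar_of_cpow_mul_eq hu one_ne_zero one_ne_zero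
    (by rw [mul_one, mul_one]; exact sub_eq_zero.mp h0)
  obtain ⟨h5, h6⟩ := h.eq_one_and_eq_of_mul_exp_eq (x := α * ω) (y := 0) hρ
    (by rw [sub_zero, abs_lt]; constructor <;> linarith [h.pos, Real.pi_pos])
    (by simpa using h4)
  have h7 : ω = 0 := (mul_eq_zero.mp h6).resolve_left (by linarith [h.three_half_lt])
  rw [h5, h7] at h3
  have h8 := cornerFactor_sub θ u
  rw [h3] at h8
  have h2 : (Real.sin θ : ℂ) ≠ 0 := by exact_mod_cast h.sin_theta_pos.ne'
  have h3 : u = 0 := by simpa [h2, -ofReal_sin] using h8.symm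
  exact hu0 h3

theorem diffContOnCl_cpow (h : IsSegmentAngles β α θ) (φ : ℝ) :
    DiffContOnCl ℂ (fun u => cornerFactor φ u ^ (α : ℂ)) (ball 0 1) :=
  diffContOnCl_cornerFactor_cpow φ (by simp; linarith [h.three_half_lt])

theorem diffContOnCl_cpow_sub_one (h : IsSegmentAngles β α θ) (φ : ℝ) :
    DiffContOnCl ℂ (fun u => cornerFactor φ u ^ ((α : ℂ) - 1)) (ball 0 1) :=
  diffContOnCl_cornerFactor_cpow φ (by simp; linarith [h.three_half_lt])

theorem diffContOnCl_segDen (h : IsSegmentAngles β α θ) :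
    DiffContOnCl ℂ (segDen α θ) (ball 0 1) :=
  (h.diffContOnCl_cpow θ).sub (h.diffContOnCl_cpow (-θ))

theorem diffContOnCl_segNum (h : IsSegmentAngles β α θ) :
    DiffContOnCl ℂ (segNum β α θ) (ball 0 1) :=
  ((h.diffContOnCl_cpow θ).smul diffContOnCl_const).sub
    ((h.diffContOnCl_cpow (-θ)).smul diffContOnCl_const)

theorem diffContOnCl_segWronskian (h : IsSegmentAngles β α θ) :
    DiffContOnCl ℂ (segWronskian β α θ) (ball 0 1) :=
  ((h.diffContOnCl_cpow_sub_one θ).smul (h.diffContOnCl_cpow_sub_one (-θ))).const_smul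
    (4 * α * Real.sin θ * Real.sin β : ℂ)

end IsSegmentAngles

theorem diffContOnCl_dslope {f : ℂ → ℂ} {R : ℝ} (hf : DiffContOnCl ℂ f (ball 0 R))
    {c : ℂ} (hc : c ∈ ball (0 : ℂ) R) : DiffContOnCl ℂ (dslope f c) (ball 0 R) := by
  refine ⟨(Complex.differentiableOn_dslope (isOpen_ball.mem_nhds hc)).mpr hf.1, ?_⟩
  have hmem : closure (ball (0 : ℂ) R) ∈ nhds c :=
    Filter.mem_of_superset (isOpen_ball.mem_nhds hc) subset_closure
  exact (continuousOn_dslope hmem).mpr ⟨hf.2, hf.differentiableAt isOpen_ball hc⟩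

theorem hasDerivAt_segDen {u : ℂ} (hu : ‖u‖ < 1) :
    HasDerivAt (segDen α θ) (α * cornerFactor θ u ^ ((α : ℂ) - 1) * -exp (θ * I) -
      α * cornerFactor (-θ) u ^ ((α : ℂ) - 1) * -exp ((-θ : ℝ) * I)) u :=
  (hasDerivAt_cornerFactor_cpow θ α hu).sub (hasDerivAt_cornerFactor_cpow (-θ) α hu)

theorem hasDerivAt_segNum {u : ℂ} (hu : ‖u‖ < 1) :
    HasDerivAt (segNum β α θ)
      (α * cornerFactor θ u ^ ((α : ℂ) - 1) * -exp (θ * I) * exp ((-β : ℝ) * I) -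
      α * cornerFactor (-θ) u ^ ((α : ℂ) - 1) * -exp ((-θ : ℝ) * I) * exp (β * I)) u :=
  ((hasDerivAt_cornerFactor_cpow θ α hu).mul_const _).sub
    ((hasDerivAt_cornerFactor_cpow (-θ) α hu).mul_const _)

theorem dslope_segDen_zero : dslope (segDen α θ) 0 0 = -2 * α * I * Real.sin θ := by
  rw [dslope_same, (hasDerivAt_segDen (by simp)).deriv]
  simp only [cornerFactor_zero, one_cpow, exp_mul_I, ← ofReal_cos, ← ofReal_sin, Real.cos_neg,
    Real.sin_neg]
  push_cast
  ring

namespace IsSegmentAngles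

theorem dslope_segDen_ne_zero (h : IsSegmentAngles β α θ) {u : ℂ} (hu : ‖u‖ ≤ 1) :
    dslope (segDen α θ) 0 u ≠ 0 := by
  rcases eq_or_ne u 0 with rfl | hu0
  · have h2 : (Real.sin θ : ℂ) ≠ 0 := by exact_mod_cast h.sin_theta_pos.ne'
    rw [dslope_segDen_zero]
    simp [h2, h.alpha_ne_zero, -ofReal_sin]
  · intro h0
    have := mul_dslope_segDen (α := α) (θ := θ) u
    rw [h0, mul_zero] at this
    exact h.segDen_ne_zero hu hu0 this.symm

theorem diffContOnCl_dslope_segDen (h : IsSegmentAngles β α θ) :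
    DiffContOnCl ℂ (dslope (segDen α θ) 0) (ball 0 1) :=
  diffContOnCl_dslope h.diffContOnCl_segDen (by simp)

/-- The map omits the interior of the segment. If it took the value `z`, the quotient `(z - e^(iβ))
/ (z - e^(-iβ))` would have argument `φ = αω` in `[β - π, π]`. Being right of the chord gives `sin φ
< 0`, and `|z| < 1` gives `sin (φ - β) > 0`; no such `φ` exists. -/
theorem mul_segDen_sub_segNum_ne_zero (h : IsSegmentAngles β α θ) {z u : ℂ} (hu : ‖u‖ ≤ 1)
    (hz1 : Real.cos β < z.re) (hz2 : ‖z‖ < 1) :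
    z * segDen α θ u - segNum β α θ u ≠ 0 := by
  intro h0
  have he : ∀ φ : ℝ, exp (φ * I) = ⟨Real.cos φ, Real.sin φ⟩ := fun φ =>
    Complex.ext (exp_ofReal_mul_I_re φ) (exp_ofReal_mul_I_im φ)
  have hp : z - exp ((-β : ℝ) * I) ≠ 0 := by
    intro hc
    have := congrArg re hc
    rw [he] at this
    simp at this
    linarith
  have hq : z - exp (β * I) ≠ 0 := by
    intro hc
    have := congrArg re hc
    rw [he] at this
    simp at this
    linarith
  have hpq : cornerFactor θ u ^ (α : ℂ) * (z - exp ((-β : ℝ) * I)) =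
      cornerFactor (-θ) u ^ (α : ℂ) * (z - exp (β * I)) := by
    unfold segDen segNum at h0
    linear_combination h0
  obtain ⟨ρ, ω, hρ, h1, h2, -, h4⟩ := h.exists_polar_of_cpow_mul_eq hu hp hq hpq
  set φ := α * ω
  set r := ρ ^ α
  have hr : 0 < r := Real.rpow_pos_of_pos hρ _
  set p := z - exp ((-β : ℝ) * I) with hp_def
  have hn : 0 < r * Complex.normSq p := mul_pos hr (Complex.normSq_pos.mpr hp)
  have hsβ := h.sin_pos
  have hcs := Real.cos_sq_add_sin_sq β
  have hz : z.re ^ 2 + z.im ^ 2 < 1 := by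
    have := Complex.sq_norm z
    rw [Complex.normSq_apply] at this
    nlinarith [norm_nonneg z]
  have key : ((r * Complex.normSq p : ℝ) : ℂ) * exp (φ * I) =
      (z - exp (β * I)) * (starRingEnd ℂ) p := by
    rw [← h4, ofReal_mul, ← Complex.mul_conj]
    ring
  have h5 : r * Complex.normSq p * Real.sin φ = 2 * Real.sin β * (Real.cos β - z.re) := by
    have := congrArg im key
    rw [im_ofReal_mul, exp_ofReal_mul_I_im] at this
    rw [this, hp_def, he, he, Real.cos_neg, Real.sin_neg]
    simp
    ring
  have h6 : r * Complex.normSq p * Real.sin (φ - β) =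
      Real.sin β * (1 - (z.re ^ 2 + z.im ^ 2)) := by
    have h7 : ((r * Complex.normSq p : ℝ) : ℂ) * exp ((φ - β : ℝ) * I) =
        (z - exp (β * I)) * (starRingEnd ℂ) p * exp ((-β : ℝ) * I) := by
      rw [← key, mul_assoc, ← exp_add]
      push_cast
      ring_nf
    have := congrArg im h7
    rw [im_ofReal_mul, exp_ofReal_mul_I_im] at this
    rw [this, hp_def, he, he, Real.cos_neg, Real.sin_neg]
    simp
    linear_combination Real.sin β * hcs
  have h8 : Real.sin φ < 0 := by
    by_contra! hc
    nlinarith [mul_nonneg hn.le hc]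
  have h9 : 0 < Real.sin (φ - β) := by
    by_contra! hc
    nlinarith [mul_nonneg hn.le (neg_nonneg.mpr hc)]
  have h10 : φ < 0 := by
    by_contra! hc
    linarith [Real.sin_nonneg_of_nonneg_of_le_pi hc h2]
  linarith [Real.sin_nonpos_of_nonpos_of_neg_pi_le (x := φ - β) (by linarith [h.pos])
    (by linarith)]

theorem diffContOnCl_faberGen (h : IsSegmentAngles β α θ) {z : ℂ}
    (hz1 : Real.cos β < z.re) (hz2 : ‖z‖ < 1) :
    DiffContOnCl ℂ (faberGen β α θ z) (ball 0 1) := by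
  have h1 : DiffContOnCl ℂ (fun u => dslope (segDen α θ) 0 u *
      (z * segDen α θ u - segNum β α θ u)) (ball 0 1) :=
    h.diffContOnCl_dslope_segDen.smul
      ((h.diffContOnCl_segDen.const_smul z).sub h.diffContOnCl_segNum)
  refine h.diffContOnCl_segWronskian.smul (h1.inv fun u hu => ?_)
  rw [closure_ball _ one_ne_zero] at hu
  have hu : ‖u‖ ≤ 1 := by simpa using hu
  exact mul_ne_zero (h.dslope_segDen_ne_zero hu) (h.mul_segDen_sub_segNum_ne_zero hu hz1 hz2)

theorem faberGen_zero_right (h : IsSegmentAngles β α θ) (z : ℂ) : faberGen β α θ z 0 = 1 := by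
  rw [faberGen, dslope_segDen_zero, segDen_zero, segNum_zero, segWronskian]
  have h2 : (Real.sin θ : ℂ) ≠ 0 := by exact_mod_cast h.sin_theta_pos.ne'
  have h3 : (Real.sin β : ℂ) ≠ 0 := by exact_mod_cast h.sin_pos.ne'
  have h4 := h.alpha_ne_zero
  simp only [cornerFactor_zero, one_cpow]
  rw [div_eq_one_iff_eq]
  · linear_combination (4 * α * Real.sin θ * Real.sin β : ℂ) * I_sq
  · simp [h2, h3, h4, -ofReal_sin]

/-- Form of the generating function on the unit circle: `ψ` is the image of the boundary point
under the exterior conformal map, which lies on the chord or on the arc of the segment. -/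
theorem exists_faberGen_eq_on_sphere (h : IsSegmentAngles β α θ) {u : ℂ} (hu : ‖u‖ = 1) :
    ∃ (c : ℝ) (ψ : ℂ), 0 ≤ c ∧
      ((ψ.re = Real.cos β ∧ ∀ z, faberGen β α θ z u = c / (z - ψ)) ∨
        (‖ψ‖ = 1 ∧ ∀ z, faberGen β α θ z u = c * ψ / (ψ - z))) := by
  have hα1 : (α : ℂ) - 1 ≠ 0 := by
    have : (α - 1 : ℝ) ≠ 0 := by linarith [h.three_half_lt]
    exact_mod_cast this
  by_cases hab : cornerFactor θ u = 0 ∨ cornerFactor (-θ) u = 0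
  -- At the preimage of a corner the Wronskian vanishes because `α > 1`, so `c = 0` and any `ψ` of
  -- modulus one will do.
  · refine ⟨0, 1, le_rfl, Or.inr ⟨norm_one, fun z => ?_⟩⟩
    have : segWronskian β α θ u = 0 := by
      rcases hab with h0 | h0 <;> simp [segWronskian, h0, zero_cpow hα1]
    simp [faberGen, this]
  push Not at hab
  obtain ⟨ha, hb⟩ := hab
  have hu0 : u ≠ 0 := by rintro rfl; simp at hu
  obtain ⟨ρ, ω, hρ, -, -, -, hA, hω⟩ := exists_polar_cornerFactor h hu.le ha hb
  have hB0 : cornerFactor (-θ) u ^ (α : ℂ) ≠ 0 := by rwa [Ne, h.cpow_eq_zero_iff]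
  have hW0 := h.segDen_ne_zero hu.le hu0
  have hD := mul_dslope_segDen (α := α) (θ := θ) u
  have hr : 0 < ρ ^ α := Real.rpow_pos_of_pos hρ _
  set r := ρ ^ α
  -- On the circle the product of the corner factors is `-u` times this real number, whose sign
  -- distinguishes the preimage of the chord from that of the arc.
  set x : ℝ := 2 * (Real.cos θ - u.re)
  have hprod : cornerFactor θ u * cornerFactor (-θ) u = -u * x := by
    rw [cornerFactor_mul]
    have h1 : u * (starRingEnd ℂ) u = 1 := by
      rw [Complex.mul_conj, Complex.normSq_eq_norm_sq, hu]; simp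
    have h2 := Complex.add_conj u
    simp only [x]
    push_cast at h2 ⊢
    linear_combination u * h2 - h1
  have hx0 : x ≠ 0 := by
    intro h0
    rw [h0, ofReal_zero, mul_zero] at hprod
    exact (mul_ne_zero ha hb) hprod
  have hJ : u * segWronskian β α θ u * x = -(4 * α * Real.sin θ * Real.sin β *
      (cornerFactor θ u ^ (α : ℂ) * cornerFactor (-θ) u ^ (α : ℂ))) := by
    have h1 : ∀ y : ℂ, y ≠ 0 → y ^ (α : ℂ) = y ^ ((α : ℂ) - 1) * y := fun y hy => by
      rw [cpow_sub _ _ hy, cpow_one, div_mul_cancel₀ _ hy]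
    rw [h1 _ ha, h1 _ hb, segWronskian]
    linear_combination (4 * α * Real.sin θ * Real.sin β *
      (cornerFactor θ u ^ ((α : ℂ) - 1) * cornerFactor (-θ) u ^ ((α : ℂ) - 1))) * hprod
  have hG : ∀ (z ψ : ℂ), segNum β α θ u = ψ * segDen α θ u → faberGen β α θ z u =
      (u * segWronskian β α θ u / segDen α θ u ^ 2) / (z - ψ) := by
    intro z ψ hψ
    have h1 : dslope (segDen α θ) 0 u = segDen α θ u / u := by
      rw [← hD, mul_div_cancel_left₀ _ hu0]
    rw [faberGen, hψ, h1, ← sub_mul]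
    rcases eq_or_ne (z - ψ) 0 with h2 | h2
    · simp [h2]
    · field_simp
  have hsθ := h.sin_theta_pos
  have hsβ := h.sin_pos
  have hα0 : 0 < α := by linarith [h.three_half_lt]
  have hxc : (x : ℂ) ≠ 0 := by exact_mod_cast hx0
  set A := cornerFactor θ u ^ (α : ℂ) with hA_def
  set B := cornerFactor (-θ) u ^ (α : ℂ) with hB_def
  have hcosβ : exp ((-β : ℝ) * I) = Real.cos β - Real.sin β * I := by
    rw [exp_mul_I, ← ofReal_cos, ← ofReal_sin, Real.cos_neg, Real.sin_neg]
    push_cast; ring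
  have hcosβ' : exp (β * I) = Real.cos β + Real.sin β * I := by
    rw [exp_mul_I, ← ofReal_cos, ← ofReal_sin]
  have hee : exp (β * I) * exp ((-β : ℝ) * I) = 1 := by
    rw [← exp_add]; simp
  rcases hω hu with ⟨rfl, hle⟩ | ⟨rfl, hle⟩
  · have hxpos : 0 < x := lt_of_le_of_ne (by simp only [x]; linarith) hx0.symm
    -- Now `A = -r B` with `r > 0`, so `ψ` is a convex combination of the corners `e^(iβ)` and
    -- `e^(-iβ)`: a point of the chord.
    rw [h.alpha_mul_theta, exp_pi_mul_I] at hA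
    have h1r : (1 + r : ℂ) ≠ 0 := by
      have : (1 + r : ℝ) ≠ 0 := by positivity
      exact_mod_cast this
    have hW : segDen α ω u = -(1 + r) * B := by
      rw [segDen, ← hA_def, ← hB_def, hA]; ring
    refine ⟨4 * α * Real.sin ω * Real.sin β / x * (r / (1 + r) ^ 2),
      (r * exp ((-β : ℝ) * I) + exp (β * I)) / (1 + r), by positivity, Or.inl ⟨?_, fun z => ?_⟩⟩
    · have : (r * exp ((-β : ℝ) * I) + exp (β * I)) / (1 + r) =
          ⟨Real.cos β, (1 - r) * Real.sin β / (1 + r)⟩ := by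
        rw [hcosβ, hcosβ', div_eq_iff h1r]
        have : (1 + r : ℝ) ≠ 0 := by positivity
        apply Complex.ext
        · simp [-ofReal_cos, -ofReal_sin]; ring
        · simp [-ofReal_cos, -ofReal_sin]; field_simp; ring
      rw [this]
    · rw [hG z ((r * exp ((-β : ℝ) * I) + exp (β * I)) / (1 + r))]
      · congr 1
        rw [hW, eq_div_of_mul_eq hxc hJ, hA]
        push_cast
        field_simp
      · rw [hW, segNum, ← hA_def, ← hB_def, hA]
        field_simp
        ring
  · have hxneg : x < 0 := lt_of_le_of_ne (by simp only [x]; linarith) hx0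
    have hφ : α * (θ - Real.pi) = β - Real.pi := by
      rw [mul_sub, h.alpha_mul_theta, h.alpha_mul_pi]; ring
    have hexp : exp ((β - Real.pi : ℝ) * I) = -exp (β * I) := by
      rw [ofReal_sub, sub_mul, exp_sub, exp_pi_mul_I, div_neg, div_one]
    -- Now `A = -r e B`, and `ψ = (r + e) / (1 + r e)` has modulus one because `r + e = e (1 + r
    -- e')` with `e'` conjugate to `e`: a point of the circle.
    rw [hφ, hexp] at hA
    set e := exp (β * I)
    set e' := exp ((-β : ℝ) * I)
    have hconj : (starRingEnd ℂ) (1 + r * e) = 1 + r * e' := by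
      rw [hcosβ, hcosβ']; simp [-ofReal_cos, -ofReal_sin, sub_eq_add_neg]
    have h1r : (1 + r * e : ℂ) ≠ 0 := by
      intro h0
      have := congrArg im h0
      rw [hcosβ'] at this
      simp [-ofReal_cos, -ofReal_sin] at this
      rcases this with h1 | h1
      · exact hr.ne' h1
      · exact hsβ.ne' h1
    have h1r' : (1 + r * e' : ℂ) ≠ 0 := by
      rw [← hconj]; exact (map_ne_zero _).mpr h1r
    have hre : (r + e : ℂ) = e * (1 + r * e') := by linear_combination (-r : ℂ) * hee
    have hW : segDen α θ u = -(1 + r * e) * B := by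
      rw [segDen, ← hA_def, ← hB_def, hA]; ring
    have hns : ((Complex.normSq (1 + r * e) : ℝ) : ℂ) = (1 + r * e) * (1 + r * e') := by
      rw [← hconj, Complex.mul_conj]
    have hc : 0 ≤ 4 * α * Real.sin θ * Real.sin β / (-x) * (r / Complex.normSq (1 + r * e)) := by
      have h1 : 0 < -x := by linarith
      have h2 := Complex.normSq_nonneg (1 + r * e)
      positivity
    refine ⟨_, (r + e) / (1 + r * e), hc, Or.inr ⟨?_, fun z => ?_⟩⟩
    · have hne : ‖e‖ = 1 := norm_exp_ofReal_mul_I β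
      rw [norm_div, hre, norm_mul, hne, one_mul, ← hconj, RCLike.norm_conj,
        div_self (norm_ne_zero_iff.mpr h1r)]
    · rw [hG z ((r + e) / (1 + r * e))]
      · rw [← neg_sub z, div_neg, ← neg_div]
        congr 1
        rw [hW, eq_div_of_mul_eq hxc hJ, hA]
        push_cast
        rw [hns, hre]
        field_simp
      · rw [hW, segNum, ← hA_def, ← hB_def, hA]
        change _ * e' - B * e = _
        field_simp
        linear_combination (-r : ℂ) * hee

/-- The supporting half plane at each boundary point gives the sign. For the comparison with `z =
0`: over the chord, `0` lies on the far side and contributes a non-positive real part; over the arc,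
`faberGen` at `0` is the constant `c`, while `Re (ψ / (ψ - z)) ≥ 1/2` for `|z| ≤ |ψ|`. -/
theorem re_faberGen_nonneg (h : IsSegmentAngles β α θ) {z u : ℂ} (hu : ‖u‖ = 1)
    (hz1 : Real.cos β < z.re) (hz2 : ‖z‖ < 1) :
    0 ≤ (faberGen β α θ z u).re ∧ (faberGen β α θ 0 u).re ≤ 2 * (faberGen β α θ z u).re := by
  obtain ⟨c, ψ, hc, ⟨hψ, hG⟩ | ⟨hψ, hG⟩⟩ := h.exists_faberGen_eq_on_sphere hu
  · have h1 : ∀ z : ℂ, (faberGen β α θ z u).re = c * (z.re - Real.cos β) / normSq (z - ψ) := by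
      intro z
      rw [hG, div_eq_mul_inv, re_ofReal_mul, Complex.inv_re, sub_re, hψ, mul_div_assoc]
    have h2 : 0 ≤ (faberGen β α θ z u).re := by
      rw [h1]
      have := Complex.normSq_nonneg (z - ψ)
      have : 0 ≤ z.re - Real.cos β := by linarith
      positivity
    have h3 : (faberGen β α θ 0 u).re ≤ 0 := by
      rw [h1]
      refine div_nonpos_of_nonpos_of_nonneg ?_ (Complex.normSq_nonneg _)
      rw [zero_re]
      nlinarith [h.cos_pos]
    exact ⟨h2, by linarith⟩
  · have hψ0 : ψ ≠ 0 := by rintro rfl; simp at hψ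
    have h0 : faberGen β α θ 0 u = c := by
      rw [hG, sub_zero, mul_div_cancel_right₀ _ hψ0]
    have hne : ψ - z ≠ 0 := by
      intro h0
      rw [sub_eq_zero.mp h0] at hψ
      linarith
    have hψ2 : normSq ψ = 1 := by rw [Complex.normSq_eq_norm_sq, hψ]; norm_num
    have hz : normSq z ≤ 1 := by
      rw [Complex.normSq_eq_norm_sq]; nlinarith [norm_nonneg z]
    have h1 : c / 2 ≤ (faberGen β α θ z u).re := by
      have hpos := Complex.normSq_pos.mpr hne
      have h2 : 1 / 2 ≤ (ψ / (ψ - z)).re := by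
        rw [Complex.div_re, ← add_div, div_le_div_iff₀ two_pos hpos]
        rw [Complex.normSq_apply] at hψ2 hz ⊢
        simp only [sub_re, sub_im]
        nlinarith
      rw [hG, mul_div_assoc, re_ofReal_mul]
      nlinarith
    rw [h0, ofReal_re]
    constructor <;> linarith

end IsSegmentAngles

end GMRES

/-! ### The pole belonging to the exterior point `0`, and the growth of the Faber polynomials there.
-/

namespace GMRES

open Metric Complex

variable {β α θ : ℝ}

/-- The asymptotic convergence factor of the circular segment: the exterior conformal map takes the
value `0` at `u = -segRate β α`. -/
noncomputable def segRate (β α : ℝ) : ℝ := 2 * Real.sin (β / α / 2)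

namespace IsSegmentAngles

theorem div_alpha_pos (h : IsSegmentAngles β α θ) : 0 < β / α :=
  div_pos h.pos (by linarith [h.three_half_lt])

theorem div_alpha_lt (h : IsSegmentAngles β α θ) : β / α < Real.pi / 3 := by
  rw [div_lt_iff₀ (by linarith [h.three_half_lt])]
  nlinarith [h.three_half_lt, h.lt, Real.pi_pos]

theorem theta_eq (h : IsSegmentAngles β α θ) : θ = Real.pi / 2 + β / α / 2 := by
  have hα : α ≠ 0 := by linarith [h.three_half_lt]
  refine mul_left_cancel₀ hα ?_
  rw [h.alpha_mul_theta]
  field_simp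
  linarith [h.alpha_mul_pi]

theorem segRate_pos (h : IsSegmentAngles β α θ) : 0 < segRate β α := by
  have := h.div_alpha_pos; have := h.div_alpha_lt
  exact mul_pos two_pos (Real.sin_pos_of_pos_of_lt_pi (by linarith) (by linarith [Real.pi_pos]))

theorem segRate_lt_one (h : IsSegmentAngles β α θ) : segRate β α < 1 := by
  have := h.div_alpha_pos; have := h.div_alpha_lt
  have h1 : Real.sin (β / α / 2) < Real.sin (Real.pi / 6) :=
    Real.sin_lt_sin_of_lt_of_le_pi_div_two (by linarith [Real.pi_pos]) (by linarith [Real.pi_pos])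
      (by linarith)
  rw [Real.sin_pi_div_six] at h1
  unfold segRate
  linarith

theorem norm_neg_segRate_lt (h : IsSegmentAngles β α θ) : ‖(-segRate β α : ℂ)‖ < 1 := by
  rw [norm_neg, norm_real, Real.norm_of_nonneg h.segRate_pos.le]
  exact h.segRate_lt_one

/-- With `q = exp (iβ / (2α))` one has `exp (iθ) = i q` and `γ = -i (q - 1/q)`, so the two corner
factors at `-γ` are `q²` and `q⁻²`. -/
theorem cornerFactor_neg_segRate (h : IsSegmentAngles β α θ) :
    cornerFactor θ (-segRate β α) =
      exp ((2 * (β / α) : ℝ) * I) * cornerFactor (-θ) (-segRate β α) := by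
  set q := exp ((β / α / 2 : ℝ) * I)
  set q' := exp ((-(β / α / 2) : ℝ) * I)
  have hqq : q * q' = 1 := by
    simp only [q, q']; rw [← exp_add]; push_cast; simp
  have hγ : (segRate β α : ℂ) = -I * (q - q') := by
    simp only [q, q', segRate, exp_mul_I, ← ofReal_cos, ← ofReal_sin, Real.cos_neg, Real.sin_neg]
    push_cast
    linear_combination (2 * sin ((β : ℂ) / α / 2)) * I_sq
  have h1 : exp (θ * I) = I * q := by
    rw [h.theta_eq, ofReal_add, add_mul, exp_add]
    congr 1
    push_cast
    exact exp_pi_div_two_mul_I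
  have h2 : exp ((-θ : ℝ) * I) = -I * q' := by
    rw [h.theta_eq, neg_add, ofReal_add, add_mul, exp_add]
    congr 1
    push_cast
    rw [neg_mul, exp_neg, exp_pi_div_two_mul_I, inv_I]
  have h3 : exp ((2 * (β / α) : ℝ) * I) = q ^ 4 := by
    simp only [q]
    rw [← exp_nat_mul]
    congr 1
    push_cast
    ring
  rw [cornerFactor, cornerFactor, h1, h2, h3, hγ]
  linear_combination (q ^ 4 - q ^ 2 * (q * q' + 1) - 1) * hqq +
    (q * q' - q ^ 2 + q ^ 4 * q' ^ 2 - q ^ 5 * q') * I_sq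

theorem segNum_neg_segRate (h : IsSegmentAngles β α θ) : segNum β α θ (-segRate β α) = 0 := by
  have hlt := h.norm_neg_segRate_lt
  have hne : ∀ φ, cornerFactor φ (-segRate β α) ≠ 0 := fun φ h0 => by
    have := cornerFactor_re_pos φ hlt
    simp [h0] at this
  obtain ⟨ρ, ω, hρ, h1, h2, h3, h4, -⟩ :=
    exists_polar_cornerFactor h hlt.le (hne _) (hne _)
  rw [h.cornerFactor_neg_segRate] at h3
  have h5 := mul_right_cancel₀ (hne _) h3
  obtain ⟨rfl, rfl⟩ := eq_one_and_eq_of_mul_exp_eq_exp hρ (by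
    have := h.div_alpha_pos; have := h.div_alpha_lt; have := h.theta_gt; have := h.theta_lt
    rw [abs_lt]; constructor <;> linarith) h5.symm
  have hα : α ≠ 0 := by linarith [h.three_half_lt]
  rw [segNum, h4, Real.one_rpow, show α * (2 * (β / α)) = β + β by field_simp; ring, ofReal_one,
    one_mul, sub_eq_zero, mul_right_comm, mul_comm]
  congr 1
  rw [← exp_add]
  push_cast
  ring_nf

theorem eq_neg_segRate_of_segNum_eq_zero (h : IsSegmentAngles β α θ) {u : ℂ} (hu : ‖u‖ ≤ 1)
    (h0 : segNum β α θ u = 0) : u = -segRate β α := by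
  obtain ⟨ρ, ω, hρ, h1, h2, h3, h4⟩ := h.exists_polar_of_cpow_mul_eq hu (exp_ne_zero _)
    (exp_ne_zero _) (sub_eq_zero.mp h0)
  have h5 : ((ρ ^ α : ℝ) : ℂ) * exp ((α * ω - β : ℝ) * I) = exp (β * I) := by
    rw [← h4, mul_assoc, ← exp_add]
    push_cast
    ring_nf
  obtain ⟨rfl, h6⟩ := h.eq_one_and_eq_of_mul_exp_eq hρ (by
    rw [abs_lt]; constructor <;> linarith [h.pos, h.lt]) h5
  have hα : α ≠ 0 := by linarith [h.three_half_lt]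
  have h7 : ω = 2 * (β / α) := by field_simp; linarith
  have h8 := h.cornerFactor_neg_segRate
  rw [h7] at h3
  set e := exp ((2 * (β / α) : ℝ) * I) with he
  -- With `ω` known, the relation between the corner factors is affine in `u`; `-segRate β α` solves
  -- it, and a second solution would force `e = 1`.
  have h9 : (u + segRate β α) * (exp (θ * I) - e * exp ((-θ : ℝ) * I)) = 0 := by
    unfold cornerFactor at h3 h8
    rw [ofReal_one] at h3
    linear_combination h8 - h3
  rcases mul_eq_zero.mp h9 with h10 | h10
  · exact eq_neg_of_add_eq_zero_left h10
  · exfalso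
    have h11 : e = 1 := by
      unfold cornerFactor at h8
      linear_combination (segRate β α : ℂ) * h10 - h8
    have := (eq_one_and_eq_of_mul_exp_eq_exp (r := 1) (x := 2 * (β / α)) (y := 0) one_pos (by
      have := h.div_alpha_pos; have := h.div_alpha_lt; have := Real.pi_pos
      rw [abs_lt]; constructor <;> linarith) (by rw [← he, h11]; simp)).2
    linarith [h.div_alpha_pos]

end IsSegmentAngles

/-- This identifies `faberGen` as `w ψ'(w) / (ψ(w) - z)` in the variable `u = 1/w`. Below it
supplies the residue at `-γ` and shows that this pole is simple. -/
theorem deriv_segNum_mul_segDen_sub {u : ℂ} (hu : ‖u‖ < 1) :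
    deriv (segNum β α θ) u * segDen α θ u - segNum β α θ u * deriv (segDen α θ) u =
      segWronskian β α θ u := by
  have h1 : ∀ φ, cornerFactor φ u ^ (α : ℂ) =
      cornerFactor φ u ^ ((α : ℂ) - 1) * cornerFactor φ u := fun φ => by
    have h0 : cornerFactor φ u ≠ 0 := fun h0 => by
      have := cornerFactor_re_pos φ hu
      simp [h0] at this
    rw [cpow_sub _ _ h0, cpow_one, div_mul_cancel₀ _ h0]
  rw [(hasDerivAt_segNum hu).deriv, (hasDerivAt_segDen hu).deriv, segNum, segDen, segWronskian,
    h1 θ, h1 (-θ)]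
  set P := cornerFactor θ u ^ ((α : ℂ) - 1)
  set Q := cornerFactor (-θ) u ^ ((α : ℂ) - 1)
  have h2 : exp (β * I) - exp ((-β : ℝ) * I) = 2 * I * Real.sin β := by
    simp only [exp_mul_I, ← ofReal_cos, ← ofReal_sin, Real.cos_neg, Real.sin_neg]
    push_cast; ring
  have h3 : exp (θ * I) - exp ((-θ : ℝ) * I) = 2 * I * Real.sin θ := by
    simp only [exp_mul_I, ← ofReal_cos, ← ofReal_sin, Real.cos_neg, Real.sin_neg]
    push_cast; ring
  simp only [cornerFactor]
  linear_combination (-α * P * Q * (exp (θ * I) - exp ((-θ : ℝ) * I))) * h2 -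
    (α * P * Q * (2 * I * Real.sin β)) * h3 - (4 * α * P * Q * Real.sin θ * Real.sin β) * I_sq

namespace IsSegmentAngles

theorem segWronskian_ne_zero (h : IsSegmentAngles β α θ) {u : ℂ} (hu : ‖u‖ < 1) :
    segWronskian β α θ u ≠ 0 := by
  have h0 : ∀ φ, cornerFactor φ u ≠ 0 := fun φ h0 => by
    have := cornerFactor_re_pos φ hu
    simp [h0] at this
  have h2 : (Real.sin θ : ℂ) ≠ 0 := by exact_mod_cast h.sin_theta_pos.ne'
  have h3 : (Real.sin β : ℂ) ≠ 0 := by exact_mod_cast h.sin_pos.ne'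
  have h4 := h.alpha_ne_zero
  simp [segWronskian, h0, h2, h3, h4, Complex.cpow_eq_zero_iff, -ofReal_sin]

/-- Splitting off the pole of the generating function at the exterior point `0`. -/
theorem exists_faberGen_zero_eq_add_pole (h : IsSegmentAngles β α θ) :
    ∃ H : ℂ → ℂ, DiffContOnCl ℂ H (ball 0 1) ∧ H 0 = 0 ∧
      ∀ u : ℂ, ‖u‖ ≤ 1 → u ≠ -segRate β α → faberGen β α θ 0 u =
        H u + segRate β α / (u + segRate β α) -
          segRate β α * u / (1 + segRate β α * u) := by
  set γ := segRate β α with hγ_def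
  have hγ0 := h.segRate_pos
  have hγ1 := h.segRate_lt_one
  rw [← hγ_def] at hγ0 hγ1
  have hγc : (γ : ℂ) ≠ 0 := by exact_mod_cast hγ0.ne'
  have hlt : ‖(-γ : ℂ)‖ < 1 := h.norm_neg_segRate_lt
  have hmem : (-γ : ℂ) ∈ ball (0 : ℂ) 1 := by simpa using hlt
  have hE0 : segNum β α θ (-γ) = 0 := h.segNum_neg_segRate
  have hmul : ∀ u, (u + γ) * dslope (segNum β α θ) (-γ) u = segNum β α θ u := fun u => by
    have := sub_smul_dslope (segNum β α θ) (-γ) u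
    rwa [hE0, sub_zero, sub_neg_eq_add, smul_eq_mul] at this
  have hW := deriv_segNum_mul_segDen_sub (β := β) (α := α) (θ := θ) hlt
  rw [hE0, zero_mul, sub_zero] at hW
  have hne : ∀ u, ‖u‖ ≤ 1 → dslope (segNum β α θ) (-γ) u ≠ 0 := by
    intro u hu
    rcases eq_or_ne u (-γ) with rfl | hu0
    · rw [dslope_same]
      intro h0
      rw [h0, zero_mul] at hW
      exact h.segWronskian_ne_zero hlt hW.symm
    · intro h0
      have := hmul u
      rw [h0, mul_zero] at this
      exact hu0 (h.eq_neg_segRate_of_segNum_eq_zero hu this.symm)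
  set M : ℂ → ℂ := fun u => segWronskian β α θ u /
    (dslope (segDen α θ) 0 u * -dslope (segNum β α θ) (-γ) u) with hM
  have hMd : DiffContOnCl ℂ M (ball 0 1) := by
    refine h.diffContOnCl_segWronskian.smul (DiffContOnCl.inv
      (h.diffContOnCl_dslope_segDen.smul (diffContOnCl_dslope h.diffContOnCl_segNum hmem).neg)
      fun u hu => ?_)
    rw [closure_ball _ one_ne_zero] at hu
    have hu : ‖u‖ ≤ 1 := by simpa using hu
    exact mul_ne_zero (h.dslope_segDen_ne_zero hu) (neg_ne_zero.mpr (hne u hu))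
  have hMγ : M (-γ) = γ := by
    have h1 := mul_dslope_segDen (α := α) (θ := θ) (-γ)
    have h2 := hne _ hlt.le
    have h3 := h.dslope_segDen_ne_zero (u := -γ) hlt.le
    simp only [hM]
    rw [← hW, ← h1, ← dslope_same (segNum β α θ)]
    field_simp
  have hG : ∀ u, faberGen β α θ 0 u = M u / (u + γ) := fun u => by
    simp only [hM, faberGen, zero_mul, zero_sub, ← hmul u]
    rw [div_div]
    congr 1
    ring
  have hden : ∀ u ∈ closure (ball (0 : ℂ) 1), 1 + γ * u ≠ 0 := by
    intro u hu h0
    rw [closure_ball _ one_ne_zero] at hu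
    have hu : ‖u‖ ≤ 1 := by simpa using hu
    have h1 : ‖(γ : ℂ) * u‖ = 1 := by
      rw [eq_neg_of_add_eq_zero_right h0, norm_neg, norm_one]
    rw [norm_mul, norm_real, Real.norm_of_nonneg hγ0.le] at h1
    nlinarith
  -- The divided difference of `M` is `faberGen` at `0` without its polar part; the added term is
  -- the reflection of that part in the unit circle, its pole `-1/γ` lying outside the disc.
  refine ⟨fun u => dslope M (-γ) u + γ * u / (1 + γ * u), ?_, ?_, fun u hu hu0 => ?_⟩
  · have h1 : DiffContOnCl ℂ (fun u : ℂ => γ * u) (ball 0 1) :=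
      Differentiable.diffContOnCl (by fun_prop)
    exact (diffContOnCl_dslope hMd hmem).add (h1.smul ((h1.const_add 1).inv hden))
  · have h1 := sub_smul_dslope M (-γ) 0
    have h2 := hG 0
    rw [h.faberGen_zero_right, zero_add, eq_div_iff hγc, one_mul] at h2
    rw [hMγ, ← h2, sub_self, smul_eq_mul] at h1
    have h3 : dslope M (-γ) 0 = 0 := (mul_eq_zero.mp h1).resolve_left (by simpa using hγc)
    simp [h3]
  · have h1 := sub_smul_dslope M (-γ) u
    rw [hMγ, sub_neg_eq_add, smul_eq_mul] at h1
    have h2 : u + γ ≠ 0 := fun h0 => hu0 (eq_neg_of_add_eq_zero_left h0)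
    have h3 := eq_div_of_mul_eq h2 ((mul_comm _ _).trans h1)
    rw [sub_div] at h3
    simp only [hG, h3]
    ring

/-- The Faber polynomials of the circular segment, normalised at `0`. -/
theorem exists_polynomial_small_on_segment (h : IsSegmentAngles β α θ) {k : ℕ} (hk : 1 ≤ k)
    (hγk : segRate β α ^ k ≤ 1 / 12) :
    ∃ P : Polynomial ℂ, P.natDegree ≤ k ∧ P.eval 0 = 1 ∧
      ∀ z : ℂ, Real.cos β < z.re → ‖z‖ < 1 → ‖P.eval z‖ ≤ 12 * segRate β α ^ k := by
  obtain ⟨H, hHd, hH0, hH⟩ := h.exists_faberGen_zero_eq_add_pole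
  set γ := segRate β α with hγ_def
  have hγ0 := h.segRate_pos
  have hγ1 := h.segRate_lt_one
  rw [← hγ_def] at hγ0 hγ1
  have hγc : (γ : ℂ) ≠ 0 := by exact_mod_cast hγ0.ne'
  have hcoefG : ∀ z : ℂ, Real.cos β < z.re → ‖z‖ < 1 →
      ‖circleCoeff (faberGen β α θ z) k 1‖ ≤ 2 := by
    intro z hz1 hz2
    have := norm_circleCoeff_le_of_re_nonneg (h.diffContOnCl_faberGen hz1 hz2)
      (fun u hu => (h.re_faberGen_nonneg (by simpa using hu) hz1 hz2).1) hk
    rwa [h.faberGen_zero_right, one_re, mul_one] at this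
  -- Carathéodory for `2 G_z - H`, with value `2` at the origin, gives `4`; the term `2 G_z` gives
  -- another `4`. Any one point `z` of the segment serves.
  have hcoefH : ‖circleCoeff H k 1‖ ≤ 8 := by
    obtain ⟨z, hz1, hz2⟩ : ∃ z : ℂ, Real.cos β < z.re ∧ ‖z‖ < 1 := by
      have h1 : Real.cos β < 1 := by
        have := Real.cos_sq_add_sin_sq β
        nlinarith [h.sin_pos, Real.cos_le_one β]
      have h2 := h.cos_pos
      refine ⟨((1 + Real.cos β) / 2 : ℝ), ?_, ?_⟩
      · rw [ofReal_re]; linarith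
      · rw [norm_real, Real.norm_of_nonneg (by linarith)]; linarith
    have hGd := h.diffContOnCl_faberGen hz1 hz2
    have hd : DiffContOnCl ℂ (fun u => 2 * faberGen β α θ z u + -1 * H u) (ball 0 1) :=
      (hGd.const_smul (2 : ℂ)).add (hHd.const_smul (-1 : ℂ))
    have hre : ∀ u ∈ sphere (0 : ℂ) 1, 0 ≤ (2 * faberGen β α θ z u + -1 * H u).re := by
      intro u hu
      have hu : ‖u‖ = 1 := by simpa using hu
      have hune : u ≠ -γ := by
        rintro rfl
        exact h.norm_neg_segRate_lt.ne hu
      have h1 := (h.re_faberGen_nonneg hu hz1 hz2).2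
      have hconj : (starRingEnd ℂ) u * u = 1 := by
        rw [mul_comm, Complex.mul_conj, Complex.normSq_eq_norm_sq, hu]; simp
      have hu0 : u ≠ 0 := by rintro rfl; simp at hu
      have h2 : (starRingEnd ℂ) (γ / (u + γ)) = γ * u / (1 + γ * u) := by
        rw [map_div₀, map_add, conj_ofReal, ← mul_div_mul_right _ _ hu0, add_mul, hconj]
      have h3 : (H u).re = (faberGen β α θ 0 u).re := by
        rw [hH u hu.le hune, ← h2, sub_re, add_re, conj_re, add_sub_cancel_right]
      have h4 : (2 * faberGen β α θ z u + -1 * H u).re =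
          2 * (faberGen β α θ z u).re - (H u).re := by simp; ring
      rw [h4, h3]
      linarith
    have h5 := norm_circleCoeff_le_of_re_nonneg hd hre hk
    have hsph : ∀ {f : ℂ → ℂ}, DiffContOnCl ℂ f (ball 0 1) → ContinuousOn f (sphere 0 1) :=
      fun hf => hf.continuousOn_ball.mono sphere_subset_closedBall
    rw [circleCoeff_add (f := fun u => 2 * faberGen β α θ z u) (g := fun u => -1 * H u) one_pos
        ((hsph hGd).const_smul (2 : ℂ)) ((hsph hHd).const_smul (-1 : ℂ)),
      circleCoeff_const_mul, circleCoeff_const_mul, hH0, h.faberGen_zero_right] at h5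
    have h6 := norm_sub_le (2 * circleCoeff (faberGen β α θ z) k 1)
      (2 * circleCoeff (faberGen β α θ z) k 1 + -1 * circleCoeff H k 1)
    rw [show 2 * circleCoeff (faberGen β α θ z) k 1 - (2 * circleCoeff (faberGen β α θ z) k 1 +
      -1 * circleCoeff H k 1) = circleCoeff H k 1 by ring, norm_mul] at h6
    have h7 := hcoefG z hz1 hz2
    norm_num at h5 h6
    linarith
  -- Any radius below `γ` avoids the pole, so on this small circle one polynomial represents the
  -- coefficient both in the segment and at `0`.
  have hr : 0 < γ / 2 := by positivity
  have hr1 : γ / 2 ≤ 1 := by linarith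
  have hsub : ball (0 : ℂ) (γ / 2) ⊆ ball 0 1 := ball_subset_ball hr1
  have hclos : ∀ u ∈ closure (ball (0 : ℂ) (γ / 2)), ‖u‖ ≤ γ / 2 := fun u hu => by
    rw [closure_ball _ hr.ne'] at hu; simpa using hu
  have hE0 : ∀ u : ℂ, ‖u‖ ≤ γ / 2 → segNum β α θ u ≠ 0 := by
    intro u hu h0
    rw [h.eq_neg_segRate_of_segNum_eq_zero (by linarith) h0, norm_neg, norm_real,
      Real.norm_of_nonneg hγ0.le] at hu
    linarith
  have hD := h.diffContOnCl_dslope_segDen.mono hsub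
  have hE := h.diffContOnCl_segNum.mono hsub
  have hh : DiffContOnCl ℂ (fun u => dslope (segDen α θ) 0 u * (segNum β α θ u)⁻¹)
      (ball 0 (γ / 2)) := hD.smul (hE.inv fun u hu => hE0 u (hclos u hu))
  have hg : DiffContOnCl ℂ (fun u => segWronskian β α θ u *
      (dslope (segDen α θ) 0 u * -segNum β α θ u)⁻¹) (ball 0 (γ / 2)) :=
    (h.diffContOnCl_segWronskian.mono hsub).smul ((hD.smul hE.neg).inv fun u hu =>
      mul_ne_zero (h.dslope_segDen_ne_zero ((hclos u hu).trans hr1))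
        (neg_ne_zero.mpr (hE0 u (hclos u hu))))
  obtain ⟨P, hPdeg, hP⟩ := exists_polynomial_eval_eq_circleCoeff hr hg hh k
  have hPz : ∀ z : ℂ, (∀ u, ‖u‖ ≤ γ / 2 → z * segDen α θ u - segNum β α θ u ≠ 0) →
      P.eval z = circleCoeff (faberGen β α θ z) k (γ / 2) := by
    intro z hz
    have hid : ∀ u : ℂ, ‖u‖ ≤ γ / 2 →
        1 - z * (u * (dslope (segDen α θ) 0 u * (segNum β α θ u)⁻¹)) =
          -(z * segDen α θ u - segNum β α θ u) / segNum β α θ u := by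
      intro u hu
      have h1 := hE0 u hu
      rw [← mul_assoc u, mul_dslope_segDen]
      field_simp
      ring
    rw [hP z fun u hu => ?_]
    · refine circleCoeff_congr hr (fun u hu => ?_) k
      have hu : ‖u‖ ≤ γ / 2 := by simpa using hu.le
      have h1 := hE0 u hu
      have h2 := hz u hu
      have h3 := h.dslope_segDen_ne_zero (hu.trans hr1)
      simp only [hid u hu, faberGen]
      field_simp
    · have hu : ‖u‖ ≤ γ / 2 := by simpa using hu
      rw [hid u hu]
      exact div_ne_zero (neg_ne_zero.mpr (hz u hu)) (hE0 u hu)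
  have hPint : ∀ z : ℂ, Real.cos β < z.re → ‖z‖ < 1 → ‖P.eval z‖ ≤ 2 := by
    intro z hz1 hz2
    rw [hPz z fun u hu => h.mul_segDen_sub_segNum_ne_zero (hu.trans hr1) hz1 hz2,
      ← circleCoeff_eq_of_le hr hr1 (h.diffContOnCl_faberGen hz1 hz2)]
    exact hcoefG z hz1 hz2
  have hP0 : P.eval 0 = circleCoeff H k 1 + ((-(γ : ℂ)⁻¹) ^ k + (-(γ : ℂ)) ^ k) := by
    rw [hPz 0 fun u hu => by simpa using hE0 u hu, circleCoeff_eq_of_le hr hr1 hHd]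
    have hlt1 : ‖-(γ : ℂ)⁻¹‖ * (γ / 2) < 1 := by
      rw [norm_neg, norm_inv, norm_real, Real.norm_of_nonneg hγ0.le]
      field_simp
      norm_num
    have hlt2 : ‖-(γ : ℂ)‖ * (γ / 2) < 1 := by
      rw [norm_neg, norm_real, Real.norm_of_nonneg hγ0.le]
      nlinarith
    rw [← circleCoeff_one_sub_inv hr hlt1, ← circleCoeff_one_sub_inv hr hlt2]
    have hne : ∀ a : ℂ, ‖a‖ * (γ / 2) < 1 → ∀ u ∈ sphere (0 : ℂ) (γ / 2), 1 - a * u ≠ 0 := by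
      intro a ha u hu h0
      have hu : ‖u‖ = γ / 2 := by simpa using hu
      have h1 : ‖a * u‖ = 1 := by rw [← sub_eq_zero.mp h0, norm_one]
      rw [norm_mul, hu] at h1
      exact ha.ne h1
    have hc : ∀ a : ℂ, ‖a‖ * (γ / 2) < 1 →
        ContinuousOn (fun u => (1 - a * u)⁻¹) (sphere 0 (γ / 2)) := fun a ha =>
      ContinuousOn.inv₀ (by fun_prop) (hne a ha)
    have hcH : ContinuousOn H (sphere 0 (γ / 2)) :=
      (hHd.mono hsub).continuousOn_ball.mono sphere_subset_closedBall
    have hsum : circleCoeff (fun u => H u +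
        ((1 - -(γ : ℂ)⁻¹ * u)⁻¹ + (1 - -(γ : ℂ) * u)⁻¹) + -1 * 1) k (γ / 2) =
          circleCoeff H k (γ / 2) + (circleCoeff (fun u => (1 - -(γ : ℂ)⁻¹ * u)⁻¹) k (γ / 2) +
            circleCoeff (fun u => (1 - -(γ : ℂ) * u)⁻¹) k (γ / 2)) := by
      have hc12 := (hc _ hlt1).add (hc _ hlt2)
      rw [circleCoeff_add
          (f := fun u => H u + ((1 - -(γ : ℂ)⁻¹ * u)⁻¹ + (1 - -(γ : ℂ) * u)⁻¹)) hr
          (hcH.add hc12) (by fun_prop),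
        circleCoeff_add (g := fun u => (1 - -(γ : ℂ)⁻¹ * u)⁻¹ + (1 - -(γ : ℂ) * u)⁻¹) hr hcH hc12,
        circleCoeff_add hr (hc _ hlt1) (hc _ hlt2), circleCoeff_const_mul,
        circleCoeff_one_eq_zero hr hk]
      ring
    rw [← hsum]
    refine circleCoeff_congr hr (fun u hu => ?_) k
    have h1 := hne _ hlt1 u hu
    have h2 := hne _ hlt2 u hu
    have hu : ‖u‖ = γ / 2 := by simpa using hu
    have hune : u ≠ -γ := by
      rintro rfl
      rw [norm_neg, norm_real, Real.norm_of_nonneg hγ0.le] at hu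
      linarith
    have h3 : u + γ ≠ 0 := fun h0 => hune (eq_neg_of_add_eq_zero_left h0)
    rw [neg_mul, sub_neg_eq_add] at h2
    have h4 : (γ : ℂ) / (u + γ) = (1 - -(γ : ℂ)⁻¹ * u)⁻¹ := by
      refine eq_inv_of_mul_eq_one_left ?_
      field_simp
      ring
    have h5 : (γ : ℂ) * u / (1 + γ * u) = 1 - (1 - -(γ : ℂ) * u)⁻¹ := by
      rw [neg_mul, sub_neg_eq_add]
      field_simp
      ring
    rw [hH u (by linarith) hune, h4, h5]
    ring
  -- The `9` is `8` from `H` plus `1` from the reflected pole. As `γ ^ k ≤ 1/12`, multiplying the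
  -- lower bound by `12 γ ^ k` leaves at least `3`, more than the bound `2` on the segment.
  have hlow : (γ ^ k)⁻¹ - 9 ≤ ‖P.eval 0‖ := by
    have h1 : ‖(-(γ : ℂ)⁻¹) ^ k‖ = (γ ^ k)⁻¹ := by
      rw [norm_pow, norm_neg, norm_inv, norm_real, Real.norm_of_nonneg hγ0.le, inv_pow]
    have h2 : ‖(-(γ : ℂ)) ^ k‖ ≤ 1 := by
      rw [norm_pow, norm_neg, norm_real, Real.norm_of_nonneg hγ0.le]
      exact pow_le_one₀ hγ0.le hγ1.le
    have h3 : ‖(-(γ : ℂ)⁻¹) ^ k‖ ≤ ‖P.eval 0‖ + (‖circleCoeff H k 1‖ + ‖(-(γ : ℂ)) ^ k‖) := by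
      rw [show (-(γ : ℂ)⁻¹) ^ k = P.eval 0 - (circleCoeff H k 1 + (-(γ : ℂ)) ^ k) by
        rw [hP0]; ring]
      exact (norm_sub_le _ _).trans (by gcongr; exact norm_add_le _ _)
    linarith
  have hγk0 : 0 < γ ^ k := by positivity
  have hinv : 12 ≤ (γ ^ k)⁻¹ := by
    rw [le_inv_comm₀ (by norm_num) hγk0]; linarith
  have hP0pos : 0 < ‖P.eval 0‖ := by linarith
  refine ⟨Polynomial.C (P.eval 0)⁻¹ * P, (Polynomial.natDegree_C_mul_le _ _).trans hPdeg, ?_, ?_⟩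
  · simp [norm_pos_iff.mp hP0pos]
  · intro z hz1 hz2
    rw [Polynomial.eval_mul, Polynomial.eval_C, norm_mul, norm_inv, inv_mul_le_iff₀ hP0pos]
    refine (hPint z hz1 hz2).trans ?_
    have h1 : (γ ^ k)⁻¹ * γ ^ k = 1 := inv_mul_cancel₀ hγk0.ne'
    nlinarith

end IsSegmentAngles

end GMRES

/-! ### Polynomials in a matrix with simple eigenvalues, and the GMRES residual. -/

namespace GMRES

variable {n : ℕ} {B : Matrix (Fin n) (Fin n) ℂ}

theorem exists_mulVec_eq_smul {z : ℂ} (hz : z ∈ spectrum ℂ B) :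
    ∃ u : EuclideanSpace ℂ (Fin n), u ≠ 0 ∧ B *ᵥ u.ofLp = z • u.ofLp := by
  rw [← Matrix.spectrum_toLin', ← Module.End.hasEigenvalue_iff_mem_spectrum] at hz
  obtain ⟨w, hw⟩ := hz.exists_hasEigenvector
  refine ⟨WithLp.toLp 2 w, fun h => hw.2 ?_, by simpa using hw.apply_eq_smul⟩
  simpa using congrArg WithLp.ofLp h

theorem exists_star_vecMul_eq_smul {z : ℂ} (hz : z ∈ spectrum ℂ B) :
    ∃ v : EuclideanSpace ℂ (Fin n), v ≠ 0 ∧ star v.ofLp ᵥ* B = z • star v.ofLp := by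
  have hzt : z ∈ spectrum ℂ Bᵀ := by
    rw [Matrix.mem_spectrum_iff_isRoot_charpoly] at hz ⊢
    rwa [Matrix.charpoly_transpose]
  obtain ⟨w, hw0, hw⟩ := exists_mulVec_eq_smul hzt
  rw [Matrix.mulVec_transpose] at hw
  refine ⟨WithLp.toLp 2 (star w.ofLp), fun h => hw0 ?_, by simpa using hw⟩
  have h1 := congrArg WithLp.ofLp h
  ext i
  simpa using congrFun h1 i

theorem norm_le_of_mem_spectrum {z : ℂ} (hz : z ∈ spectrum ℂ B) : ‖z‖ ≤ ‖B‖ := by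
  obtain ⟨u, hu0, hu⟩ := exists_mulVec_eq_smul hz
  have h := Matrix.l2_opNorm_mulVec B u
  rw [hu] at h
  have h2 : ‖z • u‖ ≤ ‖B‖ * ‖u‖ := h
  rw [norm_smul] at h2
  exact le_of_mul_le_mul_right h2 (norm_pos_iff.mpr hu0)

theorem aeval_mulVec_of_mulVec_eq_smul {z : ℂ} {u : Fin n → ℂ} (hu : B *ᵥ u = z • u)
    (P : Polynomial ℂ) : Polynomial.aeval B P *ᵥ u = P.eval z • u := by
  induction P using Polynomial.induction_on' with
  | add p q hp hq => rw [map_add, Matrix.add_mulVec, hp, hq, Polynomial.eval_add, add_smul]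
  | monomial k a =>
    have hpow : B ^ k *ᵥ u = z ^ k • u := by
      induction k with
      | zero => simp
      | succ k ih =>
        rw [pow_succ, ← Matrix.mulVec_mulVec, hu, Matrix.mulVec_smul, ih, smul_smul, pow_succ,
          mul_comm]
    rw [Polynomial.aeval_monomial, Polynomial.eval_monomial, ← Matrix.mulVec_mulVec, hpow,
      Matrix.algebraMap_eq_diagonal]
    ext i
    simp [Matrix.mulVec_diagonal, mul_assoc]

theorem HasSimpleEigenvalues.card_roots_toFinset (hB : HasSimpleEigenvalues B) :
    B.charpoly.roots.toFinset.card = n := by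
  have hmem : ∀ z, z ∈ B.charpoly.roots → z ∈ spectrum ℂ B := fun z hz =>
    Matrix.mem_spectrum_iff_isRoot_charpoly.mpr (Polynomial.isRoot_of_mem_roots hz)
  have hnodup : B.charpoly.roots.Nodup := by
    rw [Multiset.nodup_iff_count_le_one]
    intro z
    rw [Polynomial.count_roots]
    by_cases hz : z ∈ B.charpoly.roots
    · exact (hB z (hmem z hz)).le
    · rw [← Polynomial.count_roots, Multiset.count_eq_zero_of_notMem hz]
      exact zero_le_one
  rw [Multiset.toFinset_card_of_nodup hnodup,
    Polynomial.splits_iff_card_roots.mp (IsAlgClosed.splits _), Matrix.charpoly_natDegree_eq_dim,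
    Fintype.card_fin]

/-- Spectral bound for polynomials of a matrix with simple eigenvalues. -/
theorem HasSimpleEigenvalues.norm_aeval_le (hB : HasSimpleEigenvalues B) {κ : ℝ}
    (hκ : IsMaxEigenvalueCondNumber B κ) (P : Polynomial ℂ) {M : ℝ} (hM : 0 ≤ M)
    (hP : ∀ z ∈ spectrum ℂ B, ‖P.eval z‖ ≤ M) (r : EuclideanSpace ℂ (Fin n)) :
    ‖Matrix.toEuclideanLin (Polynomial.aeval B P) r‖ ≤ n * κ * M * ‖r‖ := by
  have hmem : ∀ z : B.charpoly.roots.toFinset, (z : ℂ) ∈ spectrum ℂ B := fun z =>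
    Matrix.mem_spectrum_iff_isRoot_charpoly.mpr
      (Polynomial.isRoot_of_mem_roots (Multiset.mem_toFinset.mp z.2))
  choose u hu0 hu using fun z => exists_mulVec_eq_smul (hmem z)
  choose v hv0 hv using fun z => exists_star_vecMul_eq_smul (hmem z)
  have hli : LinearIndependent ℂ u := by
    refine Module.End.eigenvectors_linearIndependent' (Matrix.toEuclideanLin B)
      (fun z : B.charpoly.roots.toFinset => (z : ℂ)) Subtype.val_injective u fun z =>
        ⟨Module.End.mem_eigenspace_iff.mpr ?_, hu0 z⟩
    rw [Matrix.toLpLin_apply, hu]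
    rfl
  have hcard : Fintype.card B.charpoly.roots.toFinset =
      Module.finrank ℂ (EuclideanSpace ℂ (Fin n)) := by
    rw [Fintype.card_coe, hB.card_roots_toFinset, finrank_euclideanSpace_fin]
  rcases isEmpty_or_nonempty B.charpoly.roots.toFinset with hemp | hne
  · have hn : n = 0 := by
      rw [← hB.card_roots_toFinset, ← Fintype.card_coe, Fintype.card_eq_zero]
    subst hn
    simp [Subsingleton.elim r 0]
  let 𝒷 := basisOfLinearIndependentOfCardEqFinrank hli hcard
  have h𝒷 : ∀ z, 𝒷 z = u z := fun z => by simp [𝒷]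
  -- Left and right eigenvectors are biorthogonal, so the coordinates of `r` in the eigenbasis are
  -- quotients of inner products, each controlled by one condition number.
  have horth : ∀ z w, z ≠ w → star (v z).ofLp ⬝ᵥ (u w).ofLp = 0 := by
    intro z w hzw
    have h1 := Matrix.dotProduct_mulVec (star (v z).ofLp) B (u w).ofLp
    rw [hu, hv, dotProduct_smul, smul_dotProduct, smul_eq_mul, smul_eq_mul] at h1
    by_contra hne
    exact hzw (Subtype.ext (mul_right_cancel₀ hne h1).symm)
  set c := 𝒷.repr r
  have hsum : r = ∑ z, c z • u z := by
    rw [← 𝒷.sum_repr r]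
    simp only [h𝒷, c]
  have hcoef : ∀ z, star (v z).ofLp ⬝ᵥ r.ofLp = c z * (star (v z).ofLp ⬝ᵥ (u z).ofLp) := by
    intro z
    conv_lhs => rw [hsum]
    rw [WithLp.ofLp_sum, dotProduct_sum, Finset.sum_eq_single z]
    · simp [dotProduct_smul]
    · intro w _ hw
      rw [WithLp.ofLp_smul, dotProduct_smul, horth z w hw.symm, smul_zero]
    · simp
  have hinner : ∀ x y : EuclideanSpace ℂ (Fin n), inner ℂ x y = star x.ofLp ⬝ᵥ y.ofLp :=
    fun x y => by rw [EuclideanSpace.inner_eq_star_dotProduct, dotProduct_comm]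
  -- Otherwise `v z` would be orthogonal to the whole eigenbasis.
  have hvu : ∀ z, inner ℂ (v z) (u z) ≠ 0 := by
    intro z h0
    rw [hinner] at h0
    have h1 : ∀ x, inner ℂ (v z) x = 0 := by
      intro x
      have h2 : (innerₛₗ ℂ (v z)) = 0 := by
        refine 𝒷.ext fun w => ?_
        rw [h𝒷, innerₛₗ_apply_apply, hinner, LinearMap.zero_apply]
        rcases eq_or_ne z w with rfl | hzw
        · exact h0
        · exact horth z w hzw
      rw [← innerₛₗ_apply_apply, h2, LinearMap.zero_apply]
    exact hv0 z (inner_self_eq_zero.mp (h1 (v z)))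
  have hterm : ∀ z, ‖c z‖ * ‖u z‖ ≤ κ * ‖r‖ := by
    intro z
    have hκz : ‖u z‖ * ‖v z‖ / ‖inner ℂ (u z) (v z)‖ ≤ κ :=
      hκ.2 ⟨z, hmem z, u z, v z, hu0 z, hv0 z, hu z, hv z, rfl⟩
    have hpos : 0 < ‖inner ℂ (v z) (u z)‖ := norm_pos_iff.mpr (hvu z)
    rw [norm_inner_symm, div_le_iff₀ hpos] at hκz
    have h1 : ‖c z‖ * ‖inner ℂ (v z) (u z)‖ ≤ ‖v z‖ * ‖r‖ := by
      rw [← norm_mul, hinner (v z) (u z), ← hcoef z, ← hinner]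
      exact norm_inner_le_norm _ _
    refine le_of_mul_le_mul_right ?_ hpos
    calc ‖c z‖ * ‖u z‖ * ‖inner ℂ (v z) (u z)‖
        = ‖u z‖ * (‖c z‖ * ‖inner ℂ (v z) (u z)‖) := by ring
      _ ≤ ‖u z‖ * (‖v z‖ * ‖r‖) := by gcongr
      _ = ‖u z‖ * ‖v z‖ * ‖r‖ := by ring
      _ ≤ κ * ‖inner ℂ (v z) (u z)‖ * ‖r‖ := by gcongr
      _ = κ * ‖r‖ * ‖inner ℂ (v z) (u z)‖ := by ring
  have happ : Matrix.toEuclideanLin (Polynomial.aeval B P) r =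
      ∑ z, c z • P.eval (z : ℂ) • u z := by
    conv_lhs => rw [hsum]
    rw [map_sum]
    refine Finset.sum_congr rfl fun z _ => ?_
    rw [map_smul, Matrix.toLpLin_apply, aeval_mulVec_of_mulVec_eq_smul (hu z)]
    rfl
  rw [happ]
  calc ‖∑ z, c z • P.eval (z : ℂ) • u z‖
      ≤ ∑ z : B.charpoly.roots.toFinset, M * (κ * ‖r‖) := by
        refine norm_sum_le_of_le _ fun z _ => ?_
        rw [norm_smul, norm_smul]
        calc ‖c z‖ * (‖P.eval (z : ℂ)‖ * ‖u z‖) = ‖P.eval (z : ℂ)‖ * (‖c z‖ * ‖u z‖) := by ring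
          _ ≤ M * (κ * ‖r‖) := mul_le_mul (hP z (hmem z)) (hterm z) (by positivity) hM
    _ = n * κ * M * ‖r‖ := by
        rw [Finset.sum_const, Finset.card_univ, hcard, finrank_euclideanSpace_fin, nsmul_eq_mul]
        ring

/-- The spectral bound for the constant polynomial `1`, tested on an eigenvector. -/
theorem HasSimpleEigenvalues.one_le_card_mul_maxCondNumber {κ : ℝ} (hκ : IsMaxEigenvalueCondNumber B κ)
    (hB : HasSimpleEigenvalues B) {z : ℂ} (hz : z ∈ spectrum ℂ B) : 1 ≤ n * κ := by
  obtain ⟨u, hu0, hu⟩ := exists_mulVec_eq_smul hz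
  have h := hB.norm_aeval_le hκ 1 zero_le_one (fun z _ => by simp) u
  rw [map_one, Matrix.toLpLin_apply, Matrix.one_mulVec, mul_one] at h
  have h1 : 1 * ‖u‖ ≤ n * κ * ‖u‖ := by rw [one_mul]; exact h
  exact le_of_mul_le_mul_right h1 (norm_pos_iff.mpr hu0)

/-- The residual polynomials bound the GMRES residual. -/
theorem IsIterate.norm_residual_le {b x₀ x : EuclideanSpace ℂ (Fin n)} {m : ℕ}
    (hx : IsIterate B b x₀ m x) {P : Polynomial ℂ} (hdeg : P.natDegree ≤ m)
    (hP0 : P.eval 0 = 1) :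
    ‖residual B b x‖ ≤ ‖Matrix.toEuclideanLin (Polynomial.aeval B P) (residual B b x₀)‖ := by
  set r := residual B b x₀ with hr
  set w := Matrix.toEuclideanLin (Polynomial.aeval B P.divX) r with hw
  have hmem : w ∈ krylov B r m := by
    rw [hw, Polynomial.aeval_eq_sum_range, map_sum, LinearMap.sum_apply]
    refine Submodule.sum_mem _ fun i _ => ?_
    rw [map_smul, LinearMap.smul_apply]
    by_cases hi : P.divX.coeff i = 0
    · rw [hi, zero_smul]; exact Submodule.zero_mem _
    · refine Submodule.smul_mem _ _ (Submodule.subset_span ⟨i, ?_, rfl⟩)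
      rw [Polynomial.coeff_divX] at hi
      have := Polynomial.le_natDegree_of_ne_zero hi
      lia
  -- With `P = X * P.divX + 1`, the competitor `x₀ - P.divX(B) r` has residual exactly `P(B) r`.
  refine (hx.2 (x₀ - w) (by simpa using Submodule.neg_mem _ hmem)).trans (le_of_eq ?_)
  congr 1
  have h1 : residual B b (x₀ - w) = r + Matrix.toEuclideanLin B w := by
    rw [hr, residual, residual, map_sub]
    abel
  have hP : P = Polynomial.X * P.divX + 1 := by
    conv_lhs => rw [← P.X_mul_divX_add]
    rw [Polynomial.coeff_zero_eq_eval_zero, hP0, Polynomial.C_1]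
  rw [h1, hw]
  conv_rhs => rw [hP]
  simp only [map_add, map_mul, map_one, Polynomial.aeval_X, Matrix.toLpLin_apply,
    LinearMap.add_apply, Matrix.one_mulVec, ← Matrix.mulVec_mulVec]
  abel

end GMRES

/-! ### The residual polynomial and the final estimate. -/

namespace GMRES

theorem isSegmentAngles_of_mem_Ioo {β : ℝ} (hβ : β ∈ Set.Ioo 0 (Real.pi / 2)) :
    IsSegmentAngles β (2 - β / Real.pi) (Real.pi / (2 - β / Real.pi)) := by
  have hpi := Real.pi_pos
  have h1 : β / Real.pi < 1 := by rw [div_lt_one hpi]; linarith [hβ.2]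
  refine ⟨hβ.1, hβ.2, by field_simp, mul_div_cancel₀ _ (by linarith)⟩

/-- Residual polynomial with the prescribed zeros `lam`, small on the spectrum. -/
theorem exists_polynomial_vanishing_and_small {ℓ k : ℕ} {lam : Fin ℓ → ℂ} (hlam0 : ∀ j, lam j ≠ 0)
    {R : ℝ} (hR : 0 < R) (hlamR : ∀ j, ‖lam j‖ ≤ R) {β : ℝ} (hβ : β ∈ Set.Ioo 0 (Real.pi / 2))
    (hk : 1 ≤ k) (hγk : segRate β (2 - β / Real.pi) ^ k ≤ 1 / 12) :
    ∃ P : Polynomial ℂ, P.natDegree ≤ ℓ + k ∧ P.eval 0 = 1 ∧ (∀ j, P.eval (lam j) = 0) ∧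
      ∀ z : ℂ, R * Real.cos β < z.re → ‖z‖ < R →
        ‖P.eval z‖ ≤ (2 * R) ^ ℓ / (∏ j, ‖lam j‖) * (12 * segRate β (2 - β / Real.pi) ^ k) := by
  obtain ⟨Q, hQdeg, hQ0, hQ⟩ :=
    (isSegmentAngles_of_mem_Ioo hβ).exists_polynomial_small_on_segment hk hγk
  have hevalQ : ∀ z : ℂ, (Q.comp (Polynomial.C (R : ℂ)⁻¹ * Polynomial.X)).eval z =
      Q.eval ((R : ℂ)⁻¹ * z) := fun z => by simp [Polynomial.eval_comp]
  have hevalF : ∀ z : ℂ, (∏ j, (1 - Polynomial.C (lam j)⁻¹ * Polynomial.X)).eval z =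
      ∏ j, (1 - (lam j)⁻¹ * z) := fun z => by simp [Polynomial.eval_prod]
  refine ⟨(∏ j, (1 - Polynomial.C (lam j)⁻¹ * Polynomial.X)) *
    Q.comp (Polynomial.C (R : ℂ)⁻¹ * Polynomial.X), ?_, ?_, fun j => ?_, fun z hz1 hz2 => ?_⟩
  · refine Polynomial.natDegree_mul_le.trans (add_le_add ?_ ?_)
    · refine (Polynomial.natDegree_prod_le _ _).trans ?_
      calc ∑ j, (1 - Polynomial.C (lam j)⁻¹ * Polynomial.X).natDegree ≤ ∑ _j : Fin ℓ, 1 := by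
            refine Finset.sum_le_sum fun j _ => (Polynomial.natDegree_sub_le _ _).trans ?_
            rw [Polynomial.natDegree_one, max_eq_right (Nat.zero_le _)]
            exact Polynomial.natDegree_C_mul_le _ _ |>.trans Polynomial.natDegree_X_le
        _ = ℓ := by simp
    · refine Polynomial.natDegree_comp_le.trans ?_
      calc Q.natDegree * (Polynomial.C (R : ℂ)⁻¹ * Polynomial.X).natDegree ≤ k * 1 :=
            Nat.mul_le_mul hQdeg
              ((Polynomial.natDegree_C_mul_le _ _).trans Polynomial.natDegree_X_le)
        _ = k := mul_one k
  · rw [Polynomial.eval_mul, hevalF, hevalQ]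
    simp [hQ0]
  · rw [Polynomial.eval_mul, hevalF, Finset.prod_eq_zero (Finset.mem_univ j), zero_mul]
    rw [inv_mul_cancel₀ (hlam0 j), sub_self]
  · rw [Polynomial.eval_mul, hevalF, hevalQ, norm_mul]
    have hRi : ((R : ℂ)⁻¹ * z) = ((R⁻¹ : ℝ) : ℂ) * z := by push_cast; rfl
    refine mul_le_mul ?_ (hQ _ ?_ ?_) (norm_nonneg _) ?_
    · rw [norm_prod]
      -- Each factor is `|λ_j - z| / |λ_j|`, and both `λ_j` and `z` have modulus at most `R`.
      calc ∏ j, ‖1 - (lam j)⁻¹ * z‖ ≤ ∏ j, (2 * R) / ‖lam j‖ := by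
            refine Finset.prod_le_prod (fun _ _ => norm_nonneg _) fun j _ => ?_
            have hpos : 0 < ‖lam j‖ := norm_pos_iff.mpr (hlam0 j)
            have h1 := norm_sub_le (1 : ℂ) ((lam j)⁻¹ * z)
            rw [norm_one, norm_mul, norm_inv] at h1
            rw [le_div_iff₀ hpos]
            have h2 : ‖lam j‖⁻¹ * ‖lam j‖ = 1 := inv_mul_cancel₀ hpos.ne'
            calc ‖1 - (lam j)⁻¹ * z‖ * ‖lam j‖ ≤ (1 + ‖lam j‖⁻¹ * ‖z‖) * ‖lam j‖ := by gcongr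
              _ = ‖lam j‖ + ‖z‖ := by linear_combination ‖z‖ * h2
              _ ≤ 2 * R := by linarith [hlamR j]
        _ = (2 * R) ^ ℓ / ∏ j, ‖lam j‖ := by simp [Finset.prod_div_distrib]
    · rw [hRi, Complex.re_ofReal_mul, lt_inv_mul_iff₀ hR]
      exact hz1
    · rw [hRi, norm_mul, Complex.norm_real, Real.norm_of_nonneg (by positivity),
        inv_mul_lt_iff₀ hR, mul_one]
      exact hz2
    · positivity

end GMRES

theorem corollary1p3 {n : ℕ} (B : Matrix (Fin n) (Fin n) ℂ)
    (hB : GMRES.HasSimpleEigenvalues B)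
    -- the sets `𝒩` and `ℋ = {Re z ≥ S}`
    (N : Set ℂ) (hNopen : IsOpen N) (hNbdd : Bornology.IsBounded N) (hN0 : (0 : ℂ) ∈ N)
    (S : ℝ) (hS : 0 < S)
    (hspec : spectrum ℂ B ⊆ N ∪ {z : ℂ | S ≤ z.re})
    (hH : ∃ z ∈ spectrum ℂ B, S ≤ z.re)
    -- the eigenvalues in `𝒩`, without repetition, none of them zero
    (ℓ : ℕ) (lam : Fin ℓ → ℂ) (hlam_inj : Function.Injective lam)
    (hlam : Set.range lam = spectrum ℂ B ∩ N) (hlam0 : ∀ j, lam j ≠ 0)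
    (κ : ℝ) (hκ : GMRES.IsMaxEigenvalueCondNumber B κ)
    (L₀ L₁ : ℝ) (hL₀ : 0 < L₀) (hL₀₁ : L₀ < L₁) (hL₁ : L₁ ≤ S)
    (Neig : ℕ)
    (hNeig : Neig = {j : Fin ℓ | lam j ∈ {z : ℂ | L₀ < z.re ∧ z.re < L₁} ∩ N}.ncard + 1)
    (δ : ℝ) (hδ : δ = (L₁ - L₀) / (4 * (n : ℝ) * κ * (Neig : ℝ)))
    (β : ℝ) (hβ : β ∈ Set.Ioo 0 (Real.pi / 2)) (hcosβ : Real.cos β = L₀ / (‖B‖ + δ))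
    (γ : ℝ) (hγ : γ = 2 * Real.sin (β / (4 - 2 * β / Real.pi)))
    (ε : ℝ) (hε : 0 < ε)
    (m : ℕ)
    (hm : (ℓ : ℝ) + (Real.log γ⁻¹)⁻¹ *
        (∑ j, Real.log (1 / ‖lam j‖) + Real.log ε⁻¹ + Real.log δ⁻¹ +
          ((ℓ : ℝ) + 1) * (Real.log (‖B‖ + δ) + Real.log 3)) ≤ (m : ℝ))
    -- the right-hand side, the starting vector, and the `m`-th GMRES iterate
    (b x₀ xm : EuclideanSpace ℂ (Fin n)) (hr₀ : GMRES.residual B b x₀ ≠ 0)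
    (hxm : GMRES.IsIterate B b x₀ m xm) :
    ‖GMRES.residual B b xm‖ / ‖GMRES.residual B b x₀‖ ≤ ε := by
  obtain ⟨z₀, hz₀, hz₀S⟩ := hH
  have hnκ : 1 ≤ n * κ := GMRES.HasSimpleEigenvalues.one_le_card_mul_maxCondNumber hκ hB hz₀
  have hNeig1 : (1 : ℝ) ≤ Neig := by rw [hNeig]; exact_mod_cast Nat.le_add_left 1 _
  have hden : 0 < 4 * (n : ℝ) * κ * Neig := by
    rw [mul_assoc 4]; positivity
  have hδ0 : 0 < δ := by rw [hδ]; exact div_pos (by linarith) hden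
  have hgap : δ * (4 * (n : ℝ) * κ * Neig) = L₁ - L₀ := by rw [hδ, div_mul_cancel₀ _ hden.ne']
  have hSB : S ≤ ‖B‖ := hz₀S.trans ((Complex.re_le_norm _).trans (GMRES.norm_le_of_mem_spectrum hz₀))
  set R := ‖B‖ + δ with hR_def
  have hR : 0 < R := by linarith
  have hnκδ : 4 * δ * (n * κ) ≤ R := by
    have h1 : 4 * δ * (n * κ) * 1 ≤ 4 * δ * (n * κ) * Neig := by gcongr
    linarith
  have hδR : 4 * δ ≤ R := by nlinarith
  have hr₀pos : 0 < ‖GMRES.residual B b x₀‖ := norm_pos_iff.mpr hr₀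
  rw [div_le_iff₀ hr₀pos]
  -- For `ε ≥ 1` monotonicity against `x₀` is enough; `ε < 1` is needed below for `12 ≤ X`.
  rcases le_or_gt 1 ε with hε1 | hε1
  · have h1 := hxm.2 x₀ (by rw [sub_self]; exact Submodule.zero_mem _)
    nlinarith
  have hang := GMRES.isSegmentAngles_of_mem_Ioo hβ
  have hγ' : γ = GMRES.segRate β (2 - β / Real.pi) := by
    rw [hγ, GMRES.segRate, div_div]
    ring_nf
  have hγ0 : 0 < γ := hγ' ▸ hang.segRate_pos
  have hγ1 : γ < 1 := hγ' ▸ hang.segRate_lt_one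
  have hlamB : ∀ j, ‖lam j‖ ≤ R := fun j => by
    have : lam j ∈ spectrum ℂ B := (hlam ▸ Set.mem_range_self j : lam j ∈ spectrum ℂ B ∩ N).1
    linarith [GMRES.norm_le_of_mem_spectrum this]
  have hlampos : ∀ j, 0 < ‖lam j‖ := fun j => norm_pos_iff.mpr (hlam0 j)
  set Λ := ∏ j, ‖lam j‖ with hΛ_def
  have hΛ0 : 0 < Λ := Finset.prod_pos fun j _ => hlampos j
  have hΛR : Λ ≤ R ^ ℓ := by
    calc Λ ≤ ∏ _j : Fin ℓ, R :=
          Finset.prod_le_prod (fun _ _ => norm_nonneg _) fun j _ => hlamB j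
      _ = R ^ ℓ := by simp
  -- The bracket in the hypothesis on `m` is `log X`, so for `m = ℓ + k` the hypothesis says `X γ ^
  -- k ≤ 1`. Since `X ≥ 12`, this also yields `k ≥ 1` and `γ ^ k ≤ 1/12`, as the Faber bound
  -- requires.
  set X := (3 * R) ^ (ℓ + 1) / (Λ * ε * δ) with hX_def
  have hX0 : 0 < X := by positivity
  have hlogX : ∑ j, Real.log (1 / ‖lam j‖) + Real.log ε⁻¹ + Real.log δ⁻¹ +
      ((ℓ : ℝ) + 1) * (Real.log R + Real.log 3) = Real.log X := by
    rw [hX_def, Real.log_div (by positivity) (by positivity), Real.log_pow,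
      Real.log_mul (by norm_num) hR.ne', Real.log_mul (by positivity) hδ0.ne',
      Real.log_mul hΛ0.ne' hε.ne', hΛ_def, Real.log_prod fun j _ => (hlampos j).ne']
    simp only [one_div, Real.log_inv, Finset.sum_neg_distrib]
    push_cast
    ring
  have hX12 : 12 ≤ X := by
    rw [hX_def, le_div_iff₀ (by positivity)]
    have h1 : (3 * R) ^ ℓ * (3 * R) = (3 * R) ^ (ℓ + 1) := (pow_succ _ _).symm
    have h2 : R ^ ℓ ≤ (3 * R) ^ ℓ := by gcongr; linarith
    calc 12 * (Λ * ε * δ) = Λ * ε * (12 * δ) := by ring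
      _ ≤ (3 * R) ^ ℓ * 1 * (3 * R) := mul_le_mul (mul_le_mul (hΛR.trans h2) hε1.le hε.le
          (by positivity)) (by linarith) (by positivity) (by positivity)
      _ = (3 * R) ^ (ℓ + 1) := by rw [mul_one, h1]
  have hlogX0 : 0 < Real.log X := Real.log_pos (by linarith)
  have hlogγ : 0 < Real.log γ⁻¹ := Real.log_pos ((one_lt_inv₀ hγ0).mpr hγ1)
  rw [hlogX] at hm
  have hmℓ : ℓ < m := by
    have h1 : 0 < (Real.log γ⁻¹)⁻¹ * Real.log X := by positivity
    exact_mod_cast (by linarith : (ℓ : ℝ) < m)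
  obtain ⟨k, rfl⟩ := Nat.exists_eq_add_of_le hmℓ.le
  have hk : 1 ≤ k := by lia
  have hXk : X * γ ^ k ≤ 1 := by
    have h1 : Real.log X ≤ k * Real.log γ⁻¹ := by
      push_cast at hm
      have h2 : (Real.log γ⁻¹)⁻¹ * Real.log X ≤ k := by linarith
      rwa [inv_mul_le_iff₀ hlogγ, mul_comm] at h2
    rw [← Real.log_pow, inv_pow] at h1
    have h2 := (Real.log_le_log_iff hX0 (by positivity)).mp h1
    rwa [le_inv_comm₀ hX0 (by positivity), ← one_div, le_div_iff₀ hX0, mul_comm] at h2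
  have hγk0 : 0 < γ ^ k := by positivity
  have hγk : γ ^ k ≤ 1 / 12 := by nlinarith
  obtain ⟨P, hPdeg, hP0, hPlam, hP⟩ := GMRES.exists_polynomial_vanishing_and_small hlam0 hR hlamB hβ hk
    (hγ' ▸ hγk)
  rw [← hγ'] at hP
  have hM : 0 ≤ (2 * R) ^ ℓ / Λ * (12 * γ ^ k) := by positivity
  have hPspec : ∀ z ∈ spectrum ℂ B, ‖P.eval z‖ ≤ (2 * R) ^ ℓ / Λ * (12 * γ ^ k) := by
    intro z hz
    rcases hspec hz with hzN | hzS
    · obtain ⟨j, rfl⟩ : z ∈ Set.range lam := hlam ▸ ⟨hz, hzN⟩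
      rw [hPlam, norm_zero]
      exact hM
    · refine hP z ?_ (by linarith [GMRES.norm_le_of_mem_spectrum hz])
      -- `R cos β = L₀ < L₁ ≤ S ≤ Re z`; the summand `δ` in `R` makes `|z| < R` strict.
      rw [hcosβ, mul_div_cancel₀ _ hR.ne']
      have : S ≤ z.re := hzS
      linarith
  refine (hxm.norm_residual_le hPdeg hP0).trans
    ((hB.norm_aeval_le hκ P hM hPspec _).trans (mul_le_mul_of_nonneg_right ?_ hr₀pos.le))
  refine le_trans ?_ (mul_le_of_le_one_right hε.le hXk)
  -- Its `4` meets the Faber constant `12`: the resulting `3 R` is the extra factor in `(3 R) ^ (ℓ +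
  -- 1)`, the other factors `2 R` being enlarged to `3 R`.
  have h1 : n * κ ≤ R / (4 * δ) := by rw [le_div_iff₀ (by positivity)]; linarith
  calc n * κ * ((2 * R) ^ ℓ / Λ * (12 * γ ^ k))
      ≤ R / (4 * δ) * ((3 * R) ^ ℓ / Λ * (12 * γ ^ k)) := by gcongr; norm_num
    _ = ε * (X * γ ^ k) := by
      rw [hX_def, pow_succ]
      field_simp
      ring
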